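/- Let $\psi:\mathbb{N}\to\mathbb{R}$ be a nonnegative function on the positive integers, let $\varphi$ be Euler's totient function, and let $\lambda$ be Lebesgue measure on $\mathbb{R}/\mathbb{Z}$, so that $\lambda(\mathbb{R}/\mathbb{Z})=1$. For each positive integer $n$ let $\mathcal{E}_n\subseteq\mathbb{R}/\mathbb{Z}$ be the image modulo $1$ of $$\bigcup_{\substack{1\le a\le n\\ \gcd(a,n)=1}}\left(\frac{a-\psi(n)}{n},\frac{a+\psi(n)}{n}\right),$$ and let $W(\psi):=\bigcap_{m=1}^\infty\bigcup_{n\ge m}\mathcal{E}_n$ be the set of points of $\mathbb{R}/\mathbb{Z}$ that lie in infinitely many of the sets $\mathcal{E}_n$. Define $f:[0,\infty)\to\mathbb{R}$ by $$f(x)=\begin{cases}0&\text{if }x=0,\\ x\exp\left\{\dfrac{\log x}{2\log(-\log x)}\right\}&\text{if }0<x<1,\ x\ne 1/e,\\ 1/e&\text{if }x=1/e,\\ 1&\text{if }x\ge 1.\end{cases}$$ If $$\sum_{n=1}^\infty f\left(\frac{\psi(n)}{n}\right)\varphi(n)=\infty,$$ then $\lambda(W(\psi))=1$. -/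

import Mathlib

namespace DuffinSchaeffer

/-- The set `E_n`, a subset of the circle `ℝ/ℤ`: the union, over the integers `1 ≤ a ≤ n` coprime
to `n`, of the intervals `((a - ψ(n))/n, (a + ψ(n))/n)` taken modulo `1`. -/
def approxSet (ψ : ℕ → ℝ) (n : ℕ) : Set UnitAddCircle :=
  ⋃ a ∈ {a : ℕ | 1 ≤ a ∧ a ≤ n ∧ Nat.Coprime a n},
    (fun x : ℝ => (x : UnitAddCircle)) '' Set.Ioo (((a : ℝ) - ψ n) / n) (((a : ℝ) + ψ n) / n)

/-- The limsup set `W(ψ)`: the points of `ℝ/ℤ` that lie in infinitely many of the sets `E_n`. -/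
def W (ψ : ℕ → ℝ) : Set UnitAddCircle :=
  ⋂ m ∈ {m : ℕ | 1 ≤ m}, ⋃ n ∈ {n : ℕ | m ≤ n}, approxSet ψ n

/-- The function `f` on `[0, ∞)`: `f 0 = 0`, `f x = x * exp (log x / (2 * log (-log x)))` for
`0 < x < 1`, and `f x = 1` for `1 ≤ x`. At the single point `x = 1/e`, where `log (-log x) = 0`,
the quotient in the exponent is read as `0`, so that `f (1/e) = 1/e`. -/
noncomputable def f (x : ℝ) : ℝ :=
  if x ≤ 0 then 0
  else if x < 1 then x * Real.exp (Real.log x / (2 * Real.log (-Real.log x)))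
  else 1

end DuffinSchaeffer

open MeasureTheory Filter Topology

namespace DuffinSchaeffer

/-! By Gallagher's zero-one law it suffices that all tail unions of the approximation sets, with
radii truncated so that they tend to 0, have measure at least one fixed `c > 0` (`volume_W_eq_one`).
If ψ(n) ≥ n^(1/3) infinitely often, a single such n supplies this (`volume_single_ge`). Otherwise
sort the large n with ψ(n) > 0 by e^(-(j+1)) < ψ(n)/n ≤ e^(-j) and shrink every radius in a block to
δ = e^(-(j+1)); in a block log n ≤ 1.5(j+1). If δ∑φ(n) stayed below `blockGain j`, roughly exp(j/(2
log j)), for all large j, each such block would contribute at most 1/j² to the series. So there is a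
rich block arbitrarily far out (`exists_block`).

In a rich block Cauchy-Schwarz reduces the claim to showing that at most O(δ(∑φ)²) pairs of reduced
fractions are within 2δ (`sum_card_closePairs_le`). When δ lcm(m,n) is large, sieving only by primes
up to z, of order j/log j, gives O(δφ(m)φ(n)) (`card_closePairs_le_of_le_lcm`). The other pairs are
summed by Rankin's trick with exponent s = 0.48/log j (`sum_le_of_lcm_le`), at a cost of about
exp(0.495 j/log j), which the gain of the block absorbs.

The divisor sum in Rankin's bound needs 1 + p^(-s) ≤ p^t for p > j^0.99. With p = j and s = t =
c/log j this reads 1 + e^(-c) ≤ e^c, with equality at c = log of the golden ratio ≈ 0.4812. That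
this is below 1/2 is why the 1/2 in `f` is enough. -/

/-! ### Measures of finite unions and of limsup sets. -/

/-- The Cauchy-Schwarz lower bound for the measure of a finite union. -/
theorem sq_sum_measureReal_le {Ω ι : Type*} [MeasurableSpace Ω] (μ : Measure Ω)
    [IsFiniteMeasure μ] (I : Finset ι) (B : ι → Set Ω) (hB : ∀ i, MeasurableSet (B i)) :
    (∑ i ∈ I, μ.real (B i)) ^ 2 ≤
      μ.real (⋃ i ∈ I, B i) * ∑ i ∈ I, ∑ j ∈ I, μ.real (B i ∩ B j) := by
  classical
  set A : Set Ω := ⋃ i ∈ I, B i with hA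
  have hAm : MeasurableSet A := Finset.measurableSet_biUnion _ fun i _ => hB i
  set g : Ω → ℝ := fun x => ∑ i ∈ I, (B i).indicator 1 x with hg
  have int1 : ∀ S : Set Ω, MeasurableSet S → Integrable (S.indicator (1 : Ω → ℝ)) μ :=
    fun S hS => (integrable_const (1 : ℝ)).indicator hS
  have hgi : Integrable g μ := integrable_finsetSum _ fun i _ => int1 _ (hB i)
  have hg1 : ∫ x, g x ∂μ = ∑ i ∈ I, μ.real (B i) := by
    rw [integral_finsetSum _ fun i _ => int1 _ (hB i)]
    exact Finset.sum_congr rfl fun i _ => integral_indicator_one (hB i)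
  have hgg : ∀ x, g x ^ 2 = ∑ i ∈ I, ∑ j ∈ I, (B i ∩ B j).indicator (1 : Ω → ℝ) x := by
    intro x
    simp only [hg, sq, Finset.sum_mul_sum]
    refine Finset.sum_congr rfl fun i _ => Finset.sum_congr rfl fun j _ => ?_
    rw [Set.inter_indicator_one]; rfl
  have hg2i : Integrable (fun x => g x ^ 2) μ := by
    simp only [hgg]
    exact integrable_finsetSum _ fun i _ => integrable_finsetSum _ fun j _ =>
      int1 _ ((hB i).inter (hB j))
  have hg2 : ∫ x, g x ^ 2 ∂μ = ∑ i ∈ I, ∑ j ∈ I, μ.real (B i ∩ B j) := by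
    simp only [hgg]
    rw [integral_finsetSum _ fun i _ => integrable_finsetSum _ fun j _ =>
      int1 _ ((hB i).inter (hB j))]
    refine Finset.sum_congr rfl fun i _ => ?_
    rw [integral_finsetSum _ fun j _ => int1 _ ((hB i).inter (hB j))]
    exact Finset.sum_congr rfl fun j _ => integral_indicator_one ((hB i).inter (hB j))
  -- This is ∫ (g - t·1_A)² ≥ 0, since g vanishes off A; the optimal t is a / u below.
  have key : ∀ t : ℝ, 2 * t * ∫ x, g x ∂μ ≤ (∫ x, g x ^ 2 ∂μ) + t ^ 2 * μ.real A := by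
    intro t
    have : ∫ x, 2 * t * g x ∂μ ≤ ∫ x, (g x ^ 2 + t ^ 2 * A.indicator (1 : Ω → ℝ) x) ∂μ := by
      refine integral_mono (hgi.const_mul _) (hg2i.add ((int1 _ hAm).const_mul _)) fun x => ?_
      by_cases hx : x ∈ A
      · simp only [Set.indicator_of_mem hx, Pi.one_apply]; nlinarith [sq_nonneg (g x - t)]
      · have : g x = 0 := Finset.sum_eq_zero fun i hi =>
          Set.indicator_of_notMem (fun h => hx (Set.mem_biUnion hi h)) _
        simp [Set.indicator_of_notMem hx, this]
    rwa [integral_const_mul, integral_add hg2i ((int1 _ hAm).const_mul _), integral_const_mul,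
      integral_indicator_one hAm] at this
  rw [hg1, hg2] at key
  set a := ∑ i ∈ I, μ.real (B i)
  set b := ∑ i ∈ I, ∑ j ∈ I, μ.real (B i ∩ B j)
  set u := μ.real A
  have hb : 0 ≤ b := Finset.sum_nonneg fun i _ => Finset.sum_nonneg fun j _ => measureReal_nonneg
  have hu : 0 ≤ u := measureReal_nonneg
  have ha : a ≤ I.card * u := by
    rw [← nsmul_eq_mul]
    exact Finset.sum_le_card_nsmul _ _ _ fun i hi =>
      measureReal_mono (Set.subset_biUnion_of_mem (u := B) hi) (measure_ne_top _ _)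
  have ha0 : 0 ≤ a := Finset.sum_nonneg fun i _ => measureReal_nonneg
  rcases hu.eq_or_lt with h0 | h0
  · rw [← h0, mul_zero] at ha
    simp [le_antisymm ha ha0, ← h0]
  · have := key (a / u)
    have h1 : 2 * (a / u) * a = 2 * (a ^ 2 / u) := by ring
    have h2 : (a / u) ^ 2 * u = a ^ 2 / u := by field_simp
    rw [h1, h2] at this
    have h3 : a ^ 2 / u ≤ b := by linarith
    rw [div_le_iff₀ h0] at h3
    linarith

/-- Finitely many points of the circle with few close pairs have large neighbourhoods. -/
theorem volume_biUnion_closedBall_ge {ι : Type*} (I : Finset ι) (x : ι → UnitAddCircle)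
    {δ C : ℝ} (hδ : 0 < δ) (hδ' : 2 * δ ≤ 1) (hC : 0 < C) (hI : I.Nonempty)
    (h : (((I ×ˢ I).filter fun q => ‖x q.1 - x q.2‖ ≤ 2 * δ).card : ℝ) ≤ C * δ * I.card ^ 2) :
    2 / C ≤ (volume : Measure UnitAddCircle).real (⋃ i ∈ I, Metric.closedBall (x i) δ) := by
  have hv : ∀ y : UnitAddCircle,
      (volume : Measure UnitAddCircle).real (Metric.closedBall y δ) = 2 * δ := by
    intro y
    rw [measureReal_def, AddCircle.volume_closedBall, min_eq_right hδ',
      ENNReal.toReal_ofReal (by positivity)]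
  have h1 := sq_sum_measureReal_le (volume : Measure UnitAddCircle) I
    (fun i => Metric.closedBall (x i) δ) fun i => measurableSet_closedBall
  simp only [hv, Finset.sum_const, nsmul_eq_mul] at h1
  have h2 : ∑ i ∈ I, ∑ j ∈ I, (volume : Measure UnitAddCircle).real
      (Metric.closedBall (x i) δ ∩ Metric.closedBall (x j) δ) ≤ 2 * δ * (C * δ * I.card ^ 2) := by
    rw [← Finset.sum_product']
    calc _ ≤ ∑ q ∈ I ×ˢ I, if ‖x q.1 - x q.2‖ ≤ 2 * δ then 2 * δ else 0 := by
          refine Finset.sum_le_sum fun q _ => ?_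
          split_ifs with hq
          · exact (measureReal_mono Set.inter_subset_left).trans (hv _).le
          · rw [Set.disjoint_iff_inter_eq_empty.mp]
            · simp
            · refine Metric.closedBall_disjoint_closedBall ?_
              rw [dist_eq_norm]; linarith
      _ = ((I ×ˢ I).filter fun q => ‖x q.1 - x q.2‖ ≤ 2 * δ).card * (2 * δ) := by
          rw [← Finset.sum_filter, Finset.sum_const, nsmul_eq_mul]
      _ ≤ _ := by nlinarith
  set u := (volume : Measure UnitAddCircle).real (⋃ i ∈ I, Metric.closedBall (x i) δ)
  have hu : 0 ≤ u := measureReal_nonneg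
  have hc : (0 : ℝ) < I.card := by exact_mod_cast hI.card_pos
  have h3 := h1.trans (mul_le_mul_of_nonneg_left h2 hu)
  rw [div_le_iff₀ hC]
  have h4 : 0 < 2 * δ ^ 2 * (I.card : ℝ) ^ 2 := by positivity
  refine le_of_mul_le_mul_right ?_ h4
  nlinarith

theorem measure_limsup_ge {Ω : Type*} [MeasurableSpace Ω] (μ : Measure Ω) [IsFiniteMeasure μ]
    (E : ℕ → Set Ω) (hE : ∀ n, MeasurableSet (E n)) {c : ℝ}
    (h : ∀ N, c ≤ μ.real (⋃ n ∈ {n | N ≤ n}, E n)) :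
    c ≤ μ.real (⋂ N, ⋃ n ∈ {n | N ≤ n}, E n) := by
  have ht : Tendsto (fun N : ℕ => μ.real (⋃ n ∈ {n | N ≤ n}, E n)) atTop
      (𝓝 (μ.real (⋂ N, ⋃ n ∈ {n | N ≤ n}, E n))) := by
    refine (ENNReal.tendsto_toReal (measure_ne_top _ _)).comp ?_
    refine tendsto_measure_iInter_atTop (fun N => ?_) ?_ ⟨0, measure_ne_top _ _⟩
    · exact (MeasurableSet.biUnion (Set.to_countable _) fun n _ => hE n).nullMeasurableSet
    · intro N M hNM
      exact Set.biUnion_subset_biUnion_left fun n (hn : M ≤ n) => (hNM.trans hn : N ≤ n)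
  exact ge_of_tendsto' ht h

/-! ### Counting pairs of fractions in a short arc. -/

theorem card_Icc_ceil_floor_le {x r : ℝ} (hr : 0 ≤ r) :
    ((Finset.Icc ⌈x - r⌉ ⌊x + r⌋).card : ℝ) ≤ 2 * r + 1 := by
  rw [Int.card_Icc]
  have h1 := Int.floor_le (x + r)
  have h2 := Int.le_ceil (x - r)
  have h3 : ((⌊x + r⌋ + 1 - ⌈x - r⌉ : ℤ) : ℝ) ≤ 2 * r + 1 := by push_cast; linarith
  rcases le_total 0 (⌊x + r⌋ + 1 - ⌈x - r⌉) with h | h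
  · rw [← Int.cast_natCast, Int.toNat_of_nonneg h]; exact h3
  · rw [Int.toNat_of_nonpos h]; push_cast; positivity

/-- The number of pairs from two cyclic groups whose difference lies in a short arc. -/
theorem card_close_pairs_le {M N : ℕ} (hM : 0 < M) (hN : 0 < N) (θ : ℝ) {η : ℝ} (hη : 0 ≤ η) :
    (((Finset.range M ×ˢ Finset.range N).filter fun q : ℕ × ℕ =>
      ‖((θ + q.1 / M - q.2 / N : ℝ) : UnitAddCircle)‖ ≤ η).card : ℝ) ≤
      Nat.gcd M N * (2 * η * Nat.lcm M N + 1) := by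
  classical
  obtain ⟨g, M', N', hg, hcop, rfl, rfl⟩ :
      ∃ g M' N' : ℕ, 0 < g ∧ Nat.Coprime M' N' ∧ M = M' * g ∧ N = N' * g := by
    obtain ⟨M', N', h1, h2, h3⟩ := Nat.exists_coprime M N
    exact ⟨_, M', N', Nat.gcd_pos_of_pos_left _ hM, h1, h2, h3⟩
  have hM' : 0 < M' := Nat.pos_of_mul_pos_right hM
  have hN' : 0 < N' := Nat.pos_of_mul_pos_right hN
  have hgcd : Nat.gcd (M' * g) (N' * g) = g := by
    rw [Nat.gcd_mul_right, hcop.gcd_eq_one, one_mul]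
  have hlcm : Nat.lcm (M' * g) (N' * g) = M' * N' * g := by
    rw [Nat.lcm_mul_right, hcop.lcm_eq_mul]
  rw [hgcd, hlcm]
  set K : ℕ := M' * N' * g with hK
  have hK0 : (0 : ℝ) < K := by exact_mod_cast Nat.mul_pos (Nat.mul_pos hM' hN') hg
  set S := (Finset.range (M' * g) ×ˢ Finset.range (N' * g)).filter fun q : ℕ × ℕ =>
      ‖((θ + q.1 / (M' * g : ℕ) - q.2 / (N' * g : ℕ) : ℝ) : UnitAddCircle)‖ ≤ η with hS
  -- With K the lcm, this integer is K times the representative of the difference nearest 0, up to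
  -- the shift θK, so it lies in an interval of length 2ηK.
  let F : ℕ × ℕ → ℤ := fun q => q.1 * N' - q.2 * M' -
    round (θ + q.1 / (M' * g : ℕ) - q.2 / (N' * g : ℕ) : ℝ) * K
  set T := Finset.Icc ⌈-(θ * K) - η * K⌉ ⌊-(θ * K) + η * K⌋ with hT
  have hmaps : ∀ q ∈ S, F q ∈ T := by
    intro q hq
    have hq2 := (Finset.mem_filter.mp hq).2
    rw [UnitAddCircle.norm_eq, abs_le] at hq2
    have hFq : (F q : ℝ) = (θ + q.1 / (M' * g : ℕ) - q.2 / (N' * g : ℕ) -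
        round (θ + q.1 / (M' * g : ℕ) - q.2 / (N' * g : ℕ) : ℝ)) * K - θ * K := by
      simp only [F]
      push_cast
      have h1 : (M' : ℝ) ≠ 0 := by positivity
      have h2 : (N' : ℝ) ≠ 0 := by positivity
      have h3 : (g : ℝ) ≠ 0 := by positivity
      have e1 : (q.1 : ℝ) * N' = q.1 / (M' * g) * K := by rw [hK]; push_cast; field_simp
      have e2 : (q.2 : ℝ) * M' = q.2 / (N' * g) * K := by rw [hK]; push_cast; field_simp
      rw [e1, e2]; ring
    rw [hT, Finset.mem_Icc, Int.ceil_le, Int.le_floor, hFq]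
    constructor <;> nlinarith
  have hfib : ∀ c ∈ T, (S.filter fun q => F q = c).card ≤ g := by
    intro c _
    rw [← Finset.card_range g]
    -- The value of F fixes a mod M', so the quotient a / M' < g recovers a; then b is fixed modulo
    -- N' * g, hence outright.
    refine Finset.card_le_card_of_injOn (fun q => q.1 / M') ?_ ?_
    · intro q hq
      have hq1 := (Finset.mem_product.mp (Finset.mem_filter.mp (Finset.mem_filter.mp hq).1).1).1
      simp only [Finset.coe_range, Set.mem_Iio]
      exact Nat.div_lt_of_lt_mul (Finset.mem_range.mp hq1)
    · rintro ⟨a, b⟩ hq ⟨a', b'⟩ hq' (hdiv : a / M' = a' / M')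
      have hq1 := Finset.mem_product.mp (Finset.mem_filter.mp (Finset.mem_filter.mp hq).1).1
      have hq1' := Finset.mem_product.mp (Finset.mem_filter.mp (Finset.mem_filter.mp hq').1).1
      simp only [Finset.mem_range] at hq1 hq1'
      have hF := (Finset.mem_filter.mp hq).2
      have hF' := (Finset.mem_filter.mp hq').2
      simp only [F] at hF hF'
      set k := round (θ + a / (M' * g : ℕ) - b / (N' * g : ℕ) : ℝ)
      set k' := round (θ + a' / (M' * g : ℕ) - b' / (N' * g : ℕ) : ℝ)
      have hKz : (K : ℤ) = M' * N' * g := by rw [hK]; push_cast; ring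
      rw [hKz] at hF hF'
      have hd : (M' : ℤ) ∣ (a - a') := by
        have : (M' : ℤ) ∣ (a - a') * N' := ⟨b - b' + (k - k') * (N' * g), by linear_combination hF - hF'⟩
        exact (Nat.isCoprime_iff_coprime.mpr hcop).dvd_of_dvd_mul_right this
      have hmod : a % M' = a' % M' := by
        have h2 : (a' : ℤ) ≡ a [ZMOD M'] := (Int.modEq_iff_dvd).mpr hd
        exact ((Int.natCast_modEq_iff.mp h2).symm)
      have ha : a = a' := by
        rw [← Nat.div_add_mod a M', ← Nat.div_add_mod a' M', hdiv, hmod]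
      subst ha
      have hd2 : ((N' * g : ℕ) : ℤ) ∣ (b - b') := by
        have : (M' : ℤ) * ((N' * g : ℕ) : ℤ) ∣ (M' : ℤ) * (b - b') :=
          ⟨k' - k, by push_cast; linear_combination hF' - hF⟩
        exact (mul_dvd_mul_iff_left (by exact_mod_cast hM'.ne')).mp this
      have h2 : (b' : ℤ) ≡ b [ZMOD (N' * g : ℕ)] := (Int.modEq_iff_dvd).mpr hd2
      have h3 := Int.natCast_modEq_iff.mp h2
      have hb : b' = b := Nat.ModEq.eq_of_lt_of_lt h3 hq1'.2 hq1.2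
      rw [hb]
  have h := Finset.card_le_mul_card_image_of_maps_to hmaps g hfib
  calc (S.card : ℝ) ≤ g * T.card := by exact_mod_cast h
    _ ≤ g * (2 * (η * K) + 1) := by
        gcongr
        exact card_Icc_ceil_floor_le (by positivity)
    _ = _ := by ring

/-- The reduced residues modulo `n`. -/
def reducedResidues (n : ℕ) : Finset ℕ := (Finset.range n).filter n.Coprime

theorem card_reducedResidues (n : ℕ) : (reducedResidues n).card = n.totient :=
  (Nat.totient_eq_card_coprime n).symm

/-- The pairs of reduced fractions with denominators `m`, `n` at distance at most `η`. -/
noncomputable def closePairs (m n : ℕ) (η : ℝ) : Finset (ℕ × ℕ) :=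
  (reducedResidues m ×ˢ reducedResidues n).filter fun q : ℕ × ℕ =>
    ‖((q.1 / m : ℝ) : UnitAddCircle) - ((q.2 / n : ℝ) : UnitAddCircle)‖ ≤ η

/-- Coprimality to m and n is relaxed to coprimality to Q and R. Writing a = Qi + α and b = Rk + β,
each residue pair (α, β) leaves a count over i < m/Q and k < n/R shifted by a constant, to which
`card_close_pairs_le` applies. -/
theorem card_closePairs_le_of_dvd {m n Q R : ℕ} (hm : 0 < m) (hn : 0 < n) (hQ : Q ∣ m)
    (hR : R ∣ n) {η : ℝ} (hη : 0 ≤ η) :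
    ((closePairs m n η).card : ℝ) ≤ Q.totient * R.totient *
      (Nat.gcd (m / Q) (n / R) * (2 * η * Nat.lcm (m / Q) (n / R) + 1)) := by
  classical
  obtain ⟨M, rfl⟩ := hQ
  obtain ⟨N, rfl⟩ := hR
  have hQ0 : 0 < Q := Nat.pos_of_mul_pos_right hm
  have hR0 : 0 < R := Nat.pos_of_mul_pos_right hn
  have hM0 : 0 < M := Nat.pos_of_mul_pos_left hm
  have hN0 : 0 < N := Nat.pos_of_mul_pos_left hn
  rw [Nat.mul_div_cancel_left _ hQ0, Nat.mul_div_cancel_left _ hR0]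
  set B : ℝ := Nat.gcd M N * (2 * η * Nat.lcm M N + 1) with hB
  have hB0 : 0 ≤ B := by positivity
  set T := reducedResidues Q ×ˢ reducedResidues R with hT
  have hmaps : ∀ q ∈ closePairs (Q * M) (R * N) η, (q.1 % Q, q.2 % R) ∈ T := by
    intro q hq
    have hq1 := Finset.mem_product.mp (Finset.mem_filter.mp hq).1
    simp only [reducedResidues, Finset.mem_filter, Finset.mem_range] at hq1
    simp only [hT, Finset.mem_product, reducedResidues, Finset.mem_filter, Finset.mem_range]
    have aux : ∀ {d e a : ℕ}, Nat.Coprime (d * e) a → Nat.Coprime d (a % d) := by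
      intro d e a h
      have := Nat.Coprime.coprime_mul_right h
      rwa [Nat.Coprime, Nat.gcd_comm, ← Nat.gcd_rec]
    exact ⟨⟨Nat.mod_lt _ hQ0, aux hq1.1.2⟩, Nat.mod_lt _ hR0, aux hq1.2.2⟩
  have hfib : ∀ t ∈ T, (((closePairs (Q * M) (R * N) η).filter
      fun q => (q.1 % Q, q.2 % R) = t).card : ℝ) ≤ B := by
    rintro ⟨α, β⟩ _
    refine le_trans ?_ (card_close_pairs_le hM0 hN0
      ((α : ℝ) / (Q * M : ℕ) - β / (R * N : ℕ)) hη)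
    norm_cast
    refine Finset.card_le_card_of_injOn (fun q => (q.1 / Q, q.2 / R)) ?_ ?_
    · rintro ⟨a, b⟩ hq
      obtain ⟨hq1, hq2⟩ := Finset.mem_filter.mp hq
      obtain ⟨hq3, hq4⟩ := Finset.mem_filter.mp hq1
      simp only [Prod.mk.injEq] at hq2
      have hq5 := Finset.mem_product.mp hq3
      simp only [reducedResidues, Finset.mem_filter, Finset.mem_range] at hq5
      simp only [Finset.coe_filter, Finset.mem_product, Finset.mem_range, Set.mem_ofPred_eq]
      refine ⟨⟨Nat.div_lt_of_lt_mul hq5.1.1, Nat.div_lt_of_lt_mul hq5.2.1⟩, ?_⟩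
      rw [← AddCircle.coe_sub] at hq4
      have ha : (a : ℝ) = Q * (a / Q : ℕ) + α := by
        rw [← hq2.1]; exact_mod_cast (Nat.div_add_mod a Q).symm
      have hb : (b : ℝ) = R * (b / R : ℕ) + β := by
        rw [← hq2.2]; exact_mod_cast (Nat.div_add_mod b R).symm
      have h1 : (Q : ℝ) ≠ 0 := by positivity
      have h2 : (R : ℝ) ≠ 0 := by positivity
      have h3 : (M : ℝ) ≠ 0 := by positivity
      have h4 : (N : ℝ) ≠ 0 := by positivity
      have e : (α : ℝ) / (Q * M : ℕ) - β / (R * N : ℕ) + (a / Q : ℕ) / M - (b / R : ℕ) / N =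
          a / (Q * M : ℕ) - b / (R * N : ℕ) := by
        rw [ha, hb]
        push_cast
        field_simp
        ring
      rw [e]
      exact hq4
    · rintro ⟨a, b⟩ hq ⟨a', b'⟩ hq' h
      have h1 := (Finset.mem_filter.mp hq).2
      have h2 := (Finset.mem_filter.mp hq').2
      simp only [Prod.mk.injEq] at h h1 h2 ⊢
      constructor
      · rw [← Nat.div_add_mod a Q, ← Nat.div_add_mod a' Q, h.1, h1.1, h2.1]
      · rw [← Nat.div_add_mod b R, ← Nat.div_add_mod b' R, h.2, h1.2, h2.2]
  calc ((closePairs (Q * M) (R * N) η).card : ℝ)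
      = ∑ t ∈ T, (((closePairs (Q * M) (R * N) η).filter
          fun q => (q.1 % Q, q.2 % R) = t).card : ℝ) := by
        exact_mod_cast Finset.card_eq_sum_card_fiberwise hmaps
    _ ≤ ∑ t ∈ T, B := Finset.sum_le_sum hfib
    _ = _ := by
        rw [Finset.sum_const, hT, Finset.card_product, card_reducedResidues,
          card_reducedResidues, nsmul_eq_mul]
        push_cast
        ring

/-! ### Sieving by the small primes. -/

/-- The product of the primes up to `z` that divide `m`. -/
def smoothRadical (z m : ℕ) : ℕ := ∏ p ∈ m.primeFactors.filter (· ≤ z), p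

theorem smoothRadical_dvd (z m : ℕ) : smoothRadical z m ∣ m :=
  (Finset.prod_dvd_prod_of_subset _ _ _ (Finset.filter_subset _ _)).trans
    (Nat.prod_primeFactors_dvd m)

theorem smoothRadical_pos (z m : ℕ) : 0 < smoothRadical z m :=
  Finset.prod_pos fun _ hp => (Nat.prime_of_mem_primeFactors (Finset.mem_filter.mp hp).1).pos

theorem smoothRadical_le (z m : ℕ) : smoothRadical z m ≤ 4 ^ z := by
  refine le_trans (Nat.le_of_dvd (primorial_pos z) ?_) (primorial_le_four_pow z)
  refine Finset.prod_dvd_prod_of_subset _ _ _ fun p hp => ?_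
  rw [Finset.mem_filter] at hp ⊢
  exact ⟨Finset.mem_range.mpr (Nat.lt_succ_of_le hp.2), Nat.prime_of_mem_primeFactors hp.1⟩

/-- Only the primes p > z separate the two densities; there are at most Kz of them, and each factor
is 1 - 1/p ≥ e^(-2/p) ≥ e^(-2/z). -/
theorem totient_smoothRadical_mul_le {z m : ℕ} {K : ℝ} (hz : 1 ≤ z)
    (hK : ((m.primeFactors.filter (¬ · ≤ z)).card : ℝ) ≤ K * z) :
    ((smoothRadical z m).totient : ℝ) * m ≤
      Real.exp (2 * K) * m.totient * smoothRadical z m := by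
  have tot : ∀ n : ℕ, (n.totient : ℝ) = n * ∏ p ∈ n.primeFactors, (1 - (p : ℝ)⁻¹) := by
    intro n
    have := Nat.totient_eq_mul_prod_factors n
    have h := congrArg (fun q : ℚ => (q : ℝ)) this
    push_cast at h
    exact h
  have hpf : (smoothRadical z m).primeFactors = m.primeFactors.filter (· ≤ z) :=
    Nat.primeFactors_prod fun p hp => Nat.prime_of_mem_primeFactors (Finset.mem_filter.mp hp).1
  rw [tot, tot, hpf, ← Finset.prod_filter_mul_prod_filter_not m.primeFactors (· ≤ z)]
  set A := ∏ p ∈ m.primeFactors.filter (· ≤ z), (1 - (p : ℝ)⁻¹)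
  have fac : ∀ p ∈ m.primeFactors, (0 : ℝ) ≤ 1 - (p : ℝ)⁻¹ := fun p hp => by
    have : (1 : ℝ) ≤ p := by exact_mod_cast (Nat.prime_of_mem_primeFactors hp).one_le
    have := inv_le_one_of_one_le₀ this
    linarith
  have hA : 0 ≤ A := Finset.prod_nonneg fun p hp => fac p (Finset.mem_filter.mp hp).1
  have hz0 : (0 : ℝ) < z := by exact_mod_cast hz
  have hB : Real.exp (-(2 * K)) ≤ ∏ p ∈ m.primeFactors.filter (¬ · ≤ z), (1 - (p : ℝ)⁻¹) := by
    calc Real.exp (-(2 * K)) ≤ Real.exp (-2 / z) ^ (m.primeFactors.filter (¬ · ≤ z)).card := by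
          rw [← Real.exp_nat_mul, Real.exp_le_exp, mul_div_assoc', le_div_iff₀ hz0]
          linarith
      _ = ∏ p ∈ m.primeFactors.filter (¬ · ≤ z), Real.exp (-2 / z) := by
          rw [Finset.prod_const]
      _ ≤ _ := by
          refine Finset.prod_le_prod (fun _ _ => (Real.exp_pos _).le) fun p hp => ?_
          obtain ⟨hp1, hp2⟩ := Finset.mem_filter.mp hp
          have hzp : (z : ℝ) < p := by exact_mod_cast not_le.mp hp2
          have hp2 : (2 : ℝ) ≤ p := by exact_mod_cast (Nat.prime_of_mem_primeFactors hp1).two_le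
          have hp0 : (0 : ℝ) < p := by linarith
          have h1 : Real.exp (-2 / z) ≤ Real.exp (-2 / p) := by
            rw [Real.exp_le_exp, neg_div, neg_div, neg_le_neg_iff]
            gcongr
          refine h1.trans ?_
          have h2 : 1 + 2 / (p : ℝ) ≤ Real.exp (2 / p) := by
            linarith [Real.add_one_le_exp (2 / (p : ℝ))]
          rw [neg_div, Real.exp_neg]
          refine (inv_anti₀ (by positivity) h2).trans ?_
          rw [inv_le_iff_one_le_mul₀ (by positivity)]
          have h3 : (p : ℝ)⁻¹ ≤ 1 / 2 := by
            rw [inv_eq_one_div]; exact one_div_le_one_div_of_le (by norm_num) hp2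
          have h4 : 0 < (p : ℝ)⁻¹ := by positivity
          rw [div_eq_mul_inv]
          nlinarith
  have h5 : 1 ≤ Real.exp (2 * K) *
      ∏ p ∈ m.primeFactors.filter (¬ · ≤ z), (1 - (p : ℝ)⁻¹) := by
    have := mul_le_mul_of_nonneg_left hB (Real.exp_pos (2 * K)).le
    rwa [← Real.exp_add, add_neg_cancel, Real.exp_zero] at this
  have h6 : 0 ≤ (smoothRadical z m : ℝ) * A * m := by positivity
  calc _ ≤ (smoothRadical z m : ℝ) * A * m * (Real.exp (2 * K) *
      ∏ p ∈ m.primeFactors.filter (¬ · ≤ z), (1 - (p : ℝ)⁻¹)) := le_mul_of_one_le_right h6 h5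
    _ = _ := by ring

theorem card_large_primeFactors_mul_log_le {z m : ℕ} (hz : 1 ≤ z) (hm : 0 < m) :
    ((m.primeFactors.filter (¬ · ≤ z)).card : ℝ) * Real.log z ≤ Real.log m := by
  have hz0 : (0 : ℝ) < z := by exact_mod_cast hz
  rw [← Real.log_pow]
  refine Real.log_le_log (by positivity) ?_
  norm_cast
  refine le_trans ?_ (Nat.le_of_dvd hm (Nat.prod_primeFactors_dvd m))
  calc z ^ (m.primeFactors.filter (¬ · ≤ z)).card
      ≤ ∏ p ∈ m.primeFactors.filter (¬ · ≤ z), p :=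
        Finset.pow_card_le_prod _ _ _ fun p hp => (not_le.mp (Finset.mem_filter.mp hp).2).le
    _ ≤ _ := Nat.le_of_dvd
        (Finset.prod_pos fun p hp => (Nat.prime_of_mem_primeFactors hp).pos)
        (Finset.prod_dvd_prod_of_subset _ _ _ (Finset.filter_subset _ _))

/-- Dividing out the two radicals, each at most 4^z, lowers the lcm by a factor of at most 16^z.
Hence 2η lcm(M,N) is still at least 1 and absorbs the `+ 1` of the lattice count; returning from the
sieved densities to φ(m) and φ(n) costs e^(2K) each. -/
theorem card_closePairs_le_of_le_lcm {z m n : ℕ} {K η : ℝ} (hz : 1 ≤ z) (hm : 0 < m) (hn : 0 < n)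
    (hKm : ((m.primeFactors.filter (¬ · ≤ z)).card : ℝ) ≤ K * z)
    (hKn : ((n.primeFactors.filter (¬ · ≤ z)).card : ℝ) ≤ K * z)
    (hη : 0 ≤ η) (h : (16 : ℝ) ^ z ≤ 2 * η * Nat.lcm m n) :
    ((closePairs m n η).card : ℝ) ≤
      4 * Real.exp (2 * K) ^ 2 * η * m.totient * n.totient := by
  obtain ⟨M, hM⟩ := smoothRadical_dvd z m
  obtain ⟨N, hN⟩ := smoothRadical_dvd z n
  have h1 := card_closePairs_le_of_dvd hm hn (smoothRadical_dvd z m) (smoothRadical_dvd z n) hη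
  have tm := totient_smoothRadical_mul_le hz hKm
  have tn := totient_smoothRadical_mul_le hz hKn
  have hQ0 := smoothRadical_pos z m
  have hR0 := smoothRadical_pos z n
  have hQ4 := smoothRadical_le z m
  have hR4 := smoothRadical_le z n
  set Q := smoothRadical z m
  set R := smoothRadical z n
  have hMQ : m / Q = M := by rw [hM, Nat.mul_div_cancel_left _ hQ0]
  have hNR : n / R = N := by rw [hN, Nat.mul_div_cancel_left _ hR0]
  rw [hMQ, hNR] at h1
  have hM0 : 0 < M := Nat.pos_of_ne_zero (by rintro rfl; simp at hM; omega)
  have hN0 : 0 < N := Nat.pos_of_ne_zero (by rintro rfl; simp at hN; omega)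
  have hlcm : Nat.lcm m n ≤ Nat.lcm M N * (Q * R) := by
    refine Nat.le_of_dvd (by have := Nat.lcm_pos hM0 hN0; positivity) (Nat.lcm_dvd ?_ ?_)
    · rw [hM, mul_comm]; exact mul_dvd_mul (Nat.dvd_lcm_left _ _) (Dvd.intro _ rfl)
    · rw [hN, mul_comm]; exact mul_dvd_mul (Nat.dvd_lcm_right _ _) (Dvd.intro_left _ rfl)
  have hQR : Q * R ≤ 16 ^ z := by
    calc Q * R ≤ 4 ^ z * 4 ^ z := Nat.mul_le_mul hQ4 hR4
      _ = 16 ^ z := by rw [← mul_pow]; norm_num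
  have h2 : (1 : ℝ) ≤ 2 * η * Nat.lcm M N := by
    have a1 : (Nat.lcm m n : ℝ) ≤ Nat.lcm M N * (16 : ℝ) ^ z := by
      have := hlcm.trans (Nat.mul_le_mul_left _ hQR)
      exact_mod_cast this
    have a2 : (16 : ℝ) ^ z * 1 ≤ 16 ^ z * (2 * η * Nat.lcm M N) := by nlinarith
    exact le_of_mul_le_mul_left a2 (by positivity)
  have hgl : (Nat.gcd M N : ℝ) * Nat.lcm M N = M * N := by exact_mod_cast Nat.gcd_mul_lcm M N
  have h3 : (Nat.gcd M N : ℝ) * (2 * η * Nat.lcm M N + 1) ≤ 4 * η * (M * N) := by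
    have : (0 : ℝ) ≤ Nat.gcd M N := by positivity
    nlinarith
  have hmr : (m : ℝ) = Q * M := by exact_mod_cast hM
  have hnr : (n : ℝ) = R * N := by exact_mod_cast hN
  have hQr : (0 : ℝ) < Q := by exact_mod_cast hQ0
  have hRr : (0 : ℝ) < R := by exact_mod_cast hR0
  have tm' : (Q.totient : ℝ) * M ≤ Real.exp (2 * K) * m.totient := by
    refine le_of_mul_le_mul_right ?_ hQr
    calc _ = (Q.totient : ℝ) * m := by rw [hmr]; ring
      _ ≤ _ := tm
  have tn' : (R.totient : ℝ) * N ≤ Real.exp (2 * K) * n.totient := by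
    refine le_of_mul_le_mul_right ?_ hRr
    calc _ = (R.totient : ℝ) * n := by rw [hnr]; ring
      _ ≤ _ := tn
  calc _ ≤ _ := h1
    _ ≤ Q.totient * R.totient * (4 * η * (M * N)) := by gcongr
    _ = 4 * η * ((Q.totient * M) * (R.totient * N)) := by ring
    _ ≤ 4 * η * ((Real.exp (2 * K) * m.totient) * (Real.exp (2 * K) * n.totient)) := by gcongr
    _ = _ := by ring

theorem le_totient_mul {z n : ℕ} {K : ℝ} (hz : 1 ≤ z)
    (hK : ((n.primeFactors.filter (¬ · ≤ z)).card : ℝ) ≤ K * z) :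
    (n : ℝ) ≤ Real.exp (2 * K) * 4 ^ z * n.totient := by
  have h := totient_smoothRadical_mul_le hz hK
  have h1 : (1 : ℝ) ≤ (smoothRadical z n).totient := by
    exact_mod_cast Nat.totient_pos.mpr (smoothRadical_pos z n)
  have h2 : (smoothRadical z n : ℝ) ≤ 4 ^ z := by exact_mod_cast smoothRadical_le z n
  calc (n : ℝ) ≤ (smoothRadical z n).totient * n := le_mul_of_one_le_left (by positivity) h1
    _ ≤ _ := h
    _ ≤ Real.exp (2 * K) * n.totient * 4 ^ z := by gcongr
    _ = _ := by ring

/-! ### Pair counts without a lower bound on the lcm. -/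

/-- Distinct reduced fractions with distinct denominators `m`, `n` are at least
`1 / lcm m n` apart. -/
theorem one_le_mul_lcm_of_closePairs_nonempty {m n : ℕ} (hm : 0 < m) (hn : 0 < n) (hmn : m ≠ n)
    {η : ℝ} (h : (closePairs m n η).Nonempty) : 1 ≤ η * Nat.lcm m n := by
  obtain ⟨⟨a, b⟩, hq⟩ := h
  obtain ⟨h1, h2⟩ := Finset.mem_filter.mp hq
  have h3 := Finset.mem_product.mp h1
  simp only [reducedResidues, Finset.mem_filter, Finset.mem_range] at h3
  rw [← AddCircle.coe_sub, UnitAddCircle.norm_eq] at h2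
  simp only at h2
  set k := round ((a : ℝ) / m - b / n)
  obtain ⟨u, hu⟩ := Nat.dvd_lcm_left m n
  obtain ⟨v, hv⟩ := Nat.dvd_lcm_right m n
  have hL : 0 < Nat.lcm m n := Nat.lcm_pos hm hn
  set l := Nat.lcm m n
  have hm0 : (m : ℝ) ≠ 0 := by positivity
  have hn0 : (n : ℝ) ≠ 0 := by positivity
  have hL0 : (0 : ℝ) < l := by exact_mod_cast hL
  have e : ((a : ℝ) / m - b / n - k) * l = ((a * u - b * v - k * l : ℤ) : ℝ) := by
    have e1 : (a : ℝ) / m * l = a * u := by rw [hu]; push_cast; field_simp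
    have e2 : (b : ℝ) / n * l = b * v := by rw [hv]; push_cast; field_simp
    push_cast
    rw [sub_mul, sub_mul, e1, e2]
  -- If the fractions agreed modulo 1, coprimality would force m ∣ n and n ∣ m.
  have hne : (a * u - b * v - k * l : ℤ) ≠ 0 := by
    intro h0
    rw [h0, Int.cast_zero, mul_eq_zero, or_iff_left hL0.ne'] at e
    have e3 : (a : ℝ) * n = (b + k * n) * m := by
      field_simp at e
      linarith
    have e4 : (a : ℤ) * n = (b + k * n) * m := by exact_mod_cast e3
    have d1 : (m : ℤ) ∣ n := by
      have : (m : ℤ) ∣ a * n := ⟨b + k * n, by rw [e4]; ring⟩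
      exact (Nat.isCoprime_iff_coprime.mpr h3.1.2).dvd_of_dvd_mul_left this
    have d2 : (n : ℤ) ∣ m := by
      have : (n : ℤ) ∣ b * m := ⟨a - k * m, by linear_combination -e4⟩
      exact (Nat.isCoprime_iff_coprime.mpr h3.2.2).dvd_of_dvd_mul_left this
    exact hmn (Nat.dvd_antisymm (Int.natCast_dvd_natCast.mp d1) (Int.natCast_dvd_natCast.mp d2))
  have h5 : (1 : ℝ) ≤ |((a * u - b * v - k * l : ℤ) : ℝ)| := by
    exact_mod_cast Int.one_le_abs hne
  rw [← e, abs_mul, abs_of_pos hL0] at h5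
  exact h5.trans (by gcongr)

/-- Either there are no pairs, or 1 ≤ η lcm(m,n) and the `+ 1` is absorbed. No sieving is done (Q =
R = 1), so m and n appear instead of their totients. -/
theorem card_closePairs_le_of_ne {m n : ℕ} (hm : 0 < m) (hn : 0 < n) (hmn : m ≠ n)
    {η : ℝ} (hη : 0 ≤ η) : ((closePairs m n η).card : ℝ) ≤ 3 * η * m * n := by
  rcases (closePairs m n η).eq_empty_or_nonempty with h | h
  · rw [h]; simp; positivity
  · have h1 := one_le_mul_lcm_of_closePairs_nonempty hm hn hmn h
    have h2 := card_closePairs_le_of_dvd hm hn (one_dvd m) (one_dvd n) hη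
    simp only [Nat.totient_one, Nat.cast_one, one_mul, Nat.div_one] at h2
    have hgl : (Nat.gcd m n : ℝ) * Nat.lcm m n = m * n := by exact_mod_cast Nat.gcd_mul_lcm m n
    have : (0 : ℝ) ≤ Nat.gcd m n := by positivity
    nlinarith

/-- For each fixed b the numerators a are counted with a trivial second group, N = 1. The surviving
1 accounts for the pairs a = b. -/
theorem card_closePairs_self_le {n : ℕ} (hn : 0 < n) {η : ℝ} (hη : 0 ≤ η) :
    ((closePairs n n η).card : ℝ) ≤ n.totient * (2 * η * n + 1) := by
  classical
  have hmaps : ∀ q ∈ closePairs n n η, q.2 ∈ reducedResidues n := fun q hq =>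
    (Finset.mem_product.mp (Finset.mem_filter.mp hq).1).2
  have hfib : ∀ b ∈ reducedResidues n,
      (((closePairs n n η).filter fun q => q.2 = b).card : ℝ) ≤ 2 * η * n + 1 := by
    intro b _
    have h := card_close_pairs_le hn one_pos (-((b : ℝ) / n)) hη
    simp only [Nat.gcd_one_right, Nat.lcm_one_right, Nat.cast_one, one_mul] at h
    refine le_trans ?_ h
    norm_cast
    refine Finset.card_le_card_of_injOn (fun q => (q.1, 0)) ?_ ?_
    · rintro ⟨a, b'⟩ hq
      obtain ⟨hq1, rfl⟩ := Finset.mem_filter.mp hq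
      obtain ⟨hq3, hq4⟩ := Finset.mem_filter.mp hq1
      have hq5 := Finset.mem_product.mp hq3
      simp only [reducedResidues, Finset.mem_filter, Finset.mem_range] at hq5
      simp only [Finset.coe_filter, Finset.mem_product, Finset.mem_range, Set.mem_ofPred_eq]
      refine ⟨⟨hq5.1.1, one_pos⟩, ?_⟩
      rw [← AddCircle.coe_sub] at hq4
      have e : -((b' : ℝ) / n) + a / n - ((0 : ℕ) : ℝ) / 1 = a / n - b' / n := by
        push_cast; ring
      rw [e]
      exact hq4
    · rintro ⟨a, b'⟩ hq ⟨a', b''⟩ hq' h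
      have h1 := (Finset.mem_filter.mp hq).2
      have h2 := (Finset.mem_filter.mp hq').2
      simp only [Prod.mk.injEq, and_true] at h h1 h2 ⊢
      exact ⟨h, h1.trans h2.symm⟩
  calc ((closePairs n n η).card : ℝ)
      = ∑ b ∈ reducedResidues n, (((closePairs n n η).filter fun q => q.2 = b).card : ℝ) := by
        exact_mod_cast Finset.card_eq_sum_card_fiberwise hmaps
    _ ≤ ∑ b ∈ reducedResidues n, (2 * η * n + 1) := Finset.sum_le_sum hfib
    _ = _ := by rw [Finset.sum_const, card_reducedResidues, nsmul_eq_mul]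

/-! ### Rankin's method and divisor sums. -/

/-- Rankin's bound for the integers `m ≤ n` having small least common multiple with `n`. -/
theorem sum_le_of_lcm_le {n : ℕ} (hn : 0 < n) {δ Y s : ℝ} (hδ : 0 < δ) (hY : 1 ≤ Y) (hs : 0 ≤ s)
    (hs1 : s ≤ 1) :
    ∑ m ∈ (Finset.Icc 1 n).filter (fun m => δ * Nat.lcm m n ≤ Y), δ * m ≤
      Y ^ 2 * (δ * n) ^ (-s) * ∑ d ∈ n.divisors, (d : ℝ) ^ (-s) := by
  classical
  set S := (Finset.Icc 1 n).filter (fun m => δ * Nat.lcm m n ≤ Y) with hS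
  have hn0 : (0 : ℝ) < n := by exact_mod_cast hn
  set B := ⌊Y / (δ * n)⌋₊ with hB
  -- Group by d = n / gcd(m,n). With m' = m / gcd(m,n) one has lcm(m,n) = m'n and m = m'n/d, so m'
  -- determines m and m' ≤ Y/(δn).
  have hmaps : ∀ m ∈ S, n / Nat.gcd m n ∈ n.divisors := fun m _ =>
    Nat.mem_divisors.mpr ⟨Nat.div_dvd_of_dvd (Nat.gcd_dvd_right m n), hn.ne'⟩
  rw [← Finset.sum_fiberwise_of_maps_to hmaps, Finset.mul_sum]
  refine Finset.sum_le_sum fun d hd => ?_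
  have hd0 : 0 < d := Nat.pos_of_mem_divisors hd
  have hdr : (0 : ℝ) < d := by exact_mod_cast hd0
  have facts : ∀ m ∈ S.filter (fun m => n / Nat.gcd m n = d),
      (m : ℝ) = (m / Nat.gcd m n : ℕ) * (n / d) ∧ m / Nat.gcd m n ∈ Finset.Icc 1 B ∧
        δ * m ≤ δ * n * (Y / (δ * n * d)) ^ s := by
    intro m hm
    obtain ⟨hm1, hm2⟩ := Finset.mem_filter.mp hm
    obtain ⟨hm3, hm4⟩ := Finset.mem_filter.mp hm1
    rw [Finset.mem_Icc] at hm3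
    have hg : 0 < Nat.gcd m n := Nat.gcd_pos_of_pos_right _ hn
    have hgr : (0 : ℝ) < Nat.gcd m n := by exact_mod_cast hg
    set m' := m / Nat.gcd m n with hm'
    have e1 : m = m' * Nat.gcd m n := (Nat.div_mul_cancel (Nat.gcd_dvd_left m n)).symm
    have e2 : n = d * Nat.gcd m n := by
      rw [← hm2]; exact (Nat.div_mul_cancel (Nat.gcd_dvd_right m n)).symm
    have e1r : (m : ℝ) = m' * Nat.gcd m n := by exact_mod_cast e1
    have e2r : (n : ℝ) = d * Nat.gcd m n := by exact_mod_cast e2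
    have hlcm : Nat.lcm m n = m' * n := by
      rw [hm', Nat.div_mul_right_comm (Nat.gcd_dvd_left m n)]; rfl
    rw [hlcm] at hm4
    push_cast at hm4
    have hm'Y : (m' : ℝ) ≤ Y / (δ * n) := by
      rw [le_div_iff₀ (by positivity)]; linarith
    have ee : (m : ℝ) = m' * (n / d) := by
      rw [e2r, mul_div_cancel_left₀ _ hdr.ne', ← e1r]
    have hm'0 : 0 < m' := Nat.pos_of_ne_zero fun h0 => by rw [h0, zero_mul] at e1; omega
    refine ⟨ee, Finset.mem_Icc.mpr ⟨hm'0, Nat.le_floor hm'Y⟩, ?_⟩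
    have hmn : (m : ℝ) / n ≤ 1 := by
      rw [div_le_one hn0]; exact_mod_cast hm3.2
    have hm0 : (0 : ℝ) < m := by exact_mod_cast hm3.1
    have hmn2 : (m : ℝ) / n ≤ Y / (δ * n * d) := by
      have : (m : ℝ) / n = m' / d := by rw [ee]; field_simp
      rw [this, div_le_div_iff₀ hdr (by positivity)]
      nlinarith
    -- Rankin's trick: m/n is at most 1, so lowering its exponent from 1 to s only increases it.
    have hmn3 : (m : ℝ) / n ≤ (Y / (δ * n * d)) ^ s := by
      calc (m : ℝ) / n = ((m : ℝ) / n) ^ (1 : ℝ) := (Real.rpow_one _).symm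
        _ ≤ ((m : ℝ) / n) ^ s := Real.rpow_le_rpow_of_exponent_ge (by positivity) hmn hs1
        _ ≤ _ := Real.rpow_le_rpow (by positivity) hmn2 hs
    calc δ * m = δ * n * (m / n) := by field_simp
      _ ≤ _ := by gcongr
  have hcard : ((S.filter (fun m => n / Nat.gcd m n = d)).card : ℝ) ≤ Y / (δ * n) := by
    calc ((S.filter (fun m => n / Nat.gcd m n = d)).card : ℝ) ≤ (Finset.Icc 1 B).card := by
          norm_cast
          refine Finset.card_le_card_of_injOn (fun m => m / Nat.gcd m n)
            (fun m hm => (facts m hm).2.1) ?_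
          intro m hm m' hm' (h : m / Nat.gcd m n = m' / Nat.gcd m' n)
          have h1 := (facts m hm).1
          have h2 := (facts m' hm').1
          rw [h, ← h2] at h1
          exact_mod_cast h1
      _ ≤ Y / (δ * n) := by
          rw [Nat.card_Icc, Nat.add_sub_cancel]; exact Nat.floor_le (by positivity)
  calc ∑ m ∈ S.filter (fun m => n / Nat.gcd m n = d), δ * (m : ℝ)
      ≤ (S.filter (fun m => n / Nat.gcd m n = d)).card • (δ * n * (Y / (δ * n * d)) ^ s) :=
        Finset.sum_le_card_nsmul _ _ _ fun m hm => (facts m hm).2.2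
    _ ≤ (Y / (δ * n)) * (δ * n * (Y / (δ * n * d)) ^ s) := by
        rw [nsmul_eq_mul]; gcongr
    _ = Y * (Y / (δ * n * d)) ^ s := by field_simp
    _ = Y * (Y ^ s * ((δ * n) ^ (-s) * d ^ (-s))) := by
        rw [Real.div_rpow (by positivity) (by positivity),
          Real.mul_rpow (by positivity) (by positivity),
          Real.rpow_neg (by positivity), Real.rpow_neg (by positivity), div_eq_mul_inv, mul_inv]
    _ ≤ Y * (Y * ((δ * n) ^ (-s) * d ^ (-s))) := by
        gcongr
        calc Y ^ s ≤ Y ^ (1 : ℝ) := Real.rpow_le_rpow_of_exponent_le hY hs1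
          _ = Y := Real.rpow_one Y
    _ = _ := by ring

theorem sum_divisors_rpow_mul_le (a b : ℕ) (s : ℝ) :
    ∑ d ∈ (a * b).divisors, (d : ℝ) ^ s ≤
      (∑ d ∈ a.divisors, (d : ℝ) ^ s) * ∑ d ∈ b.divisors, (d : ℝ) ^ s := by
  classical
  have hsub : (a * b).divisors ⊆ (a.divisors ×ˢ b.divisors).image fun q => q.1 * q.2 := by
    rw [Nat.divisors_mul]
    intro x hx
    obtain ⟨u, hu, v, hv, rfl⟩ := Finset.mem_mul.mp hx
    exact Finset.mem_image.mpr ⟨(u, v), Finset.mem_product.mpr ⟨hu, hv⟩, rfl⟩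
  calc _ ≤ ∑ d ∈ ((a.divisors ×ˢ b.divisors).image (fun q => q.1 * q.2) : Finset ℕ),
          (d : ℝ) ^ s :=
        Finset.sum_le_sum_of_subset_of_nonneg hsub fun _ _ _ => by positivity
    _ ≤ ∑ q ∈ a.divisors ×ˢ b.divisors, ((q.1 * q.2 : ℕ) : ℝ) ^ s := by
        exact Finset.sum_image_le_of_nonneg (f := fun d : ℕ => (d : ℝ) ^ s) fun _ _ => by positivity
    _ = _ := by
        rw [Finset.sum_mul_sum, Finset.sum_product]
        refine Finset.sum_congr rfl fun i _ => Finset.sum_congr rfl fun j _ => ?_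
        rw [Nat.cast_mul, Real.mul_rpow (by positivity) (by positivity)]

/-- Submultiplicativity bounds the sum by (1 + p^(-s))^k. -/
theorem sum_divisors_rpow_prime_pow_le {p : ℕ} (hp : p.Prime) {s t : ℝ}
    (h : 1 + (p : ℝ) ^ (-s) ≤ (p : ℝ) ^ t) (k : ℕ) :
    ∑ d ∈ (p ^ k).divisors, (d : ℝ) ^ (-s) ≤ ((p ^ k : ℕ) : ℝ) ^ t := by
  induction k with
  | zero => simp
  | succ k ih =>
    have hp1 : ∑ d ∈ p.divisors, (d : ℝ) ^ (-s) ≤ (p : ℝ) ^ t := by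
      rw [hp.sum_divisors]; simpa [add_comm] using h
    rw [pow_succ]
    refine (sum_divisors_rpow_mul_le _ _ _).trans ?_
    rw [Nat.cast_mul, Real.mul_rpow (by positivity) (by positivity)]
    gcongr

/-- Prime powers with p > z are paid for by n^t. Each of the at most z smaller primes costs at most
the number k + 1 ≤ log₂ N + 1 of divisors of its power. -/
theorem sum_divisors_rpow_le {z N : ℕ} {s t X : ℝ} (hs : 0 ≤ s) (ht : 0 ≤ t)
    (hX : (Nat.log 2 N + 1 : ℝ) ≤ X)
    (hz : ∀ p : ℕ, p.Prime → z < p → 1 + (p : ℝ) ^ (-s) ≤ (p : ℝ) ^ t) {n : ℕ} (hn : 0 < n)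
    (hnN : n ≤ N) :
    ∑ d ∈ n.divisors, (d : ℝ) ^ (-s) ≤ (n : ℝ) ^ t * X ^ z := by
  have hX1 : 1 ≤ X := le_trans (by simp) hX
  have main : ∀ n : ℕ, 0 < n → n ≤ N → ∑ d ∈ n.divisors, (d : ℝ) ^ (-s) ≤
      (n : ℝ) ^ t * X ^ (n.primeFactors.filter (· ≤ z)).card := by
    intro n
    induction n using Nat.recOnPosPrimePosCoprime with
    | zero => intro h; omega
    | one => intro _ _; simp
    | prime_pow p k hp hk =>
      intro _ hN
      rw [Nat.primeFactors_prime_pow hk.ne' hp, Finset.filter_singleton]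
      split_ifs with hpz
      · rw [Finset.card_singleton, pow_one]
        have hpk : (1 : ℝ) ≤ ((p ^ k : ℕ) : ℝ) := by
          exact_mod_cast Nat.one_le_pow _ _ hp.pos
        have h1 : ∑ d ∈ (p ^ k).divisors, (d : ℝ) ^ (-s) ≤ (k + 1 : ℕ) := by
          have : (p ^ k).divisors.card = k + 1 := by
            rw [Nat.divisors_prime_pow hp, Finset.card_map, Finset.card_range]
          rw [← this, ← nsmul_one]
          refine Finset.sum_le_card_nsmul _ _ _ fun d hd => ?_
          exact Real.rpow_le_one_of_one_le_of_nonpos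
            (by exact_mod_cast Nat.pos_of_mem_divisors hd) (by linarith)
        have h2 : k ≤ Nat.log 2 N :=
          Nat.le_log_of_pow_le (by norm_num) ((Nat.pow_le_pow_left hp.two_le k).trans hN)
        have h3 : ((k + 1 : ℕ) : ℝ) ≤ X := by
          refine le_trans ?_ hX
          exact_mod_cast Nat.succ_le_succ h2
        exact h1.trans (h3.trans (le_mul_of_one_le_left (by linarith) (Real.one_le_rpow hpk ht)))
      · rw [Finset.card_empty, pow_zero, mul_one]
        exact sum_divisors_rpow_prime_pow_le hp (hz p hp (not_le.mp hpz)) k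
    | coprime a b ha hb hab iha ihb =>
      intro hab0 hN
      have ha0 : 0 < a := by omega
      have hb0 : 0 < b := by omega
      refine (sum_divisors_rpow_mul_le _ _ _).trans ?_
      have h1 := iha ha0 ((Nat.le_mul_of_pos_right a hb0).trans hN)
      have h2 := ihb hb0 ((Nat.le_mul_of_pos_left b ha0).trans hN)
      have hc : ((a * b).primeFactors.filter (· ≤ z)).card =
          (a.primeFactors.filter (· ≤ z)).card + (b.primeFactors.filter (· ≤ z)).card := by
        rw [hab.primeFactors_mul, Finset.filter_union, Finset.card_union_of_disjoint]
        exact Finset.disjoint_filter_filter hab.disjoint_primeFactors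
      rw [hc, pow_add, Nat.cast_mul, Real.mul_rpow (by positivity) (by positivity)]
      calc _ ≤ _ := mul_le_mul h1 h2 (Finset.sum_nonneg fun _ _ => by positivity) (by positivity)
        _ = _ := by ring
  refine (main n hn hnN).trans ?_
  gcongr
  calc (n.primeFactors.filter (· ≤ z)).card ≤ (Finset.Icc 1 z).card := by
        refine Finset.card_le_card fun p hp => ?_
        obtain ⟨h1, h2⟩ := Finset.mem_filter.mp hp
        exact Finset.mem_Icc.mpr ⟨(Nat.prime_of_mem_primeFactors h1).pos, h2⟩
    _ = z := by simp

/-- The inequality which makes the constant `1 / 2` in the exponent of `f` sufficient. -/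
theorem one_add_rpow_neg_le {l p : ℝ} (hl : 0 < l) (hp : 0 < p) (h : 0.99 * l ≤ Real.log p) :
    1 + p ^ (-(0.48 / l)) ≤ p ^ (0.49 / l) := by
  set y := Real.log p / l with hy
  have hy1 : 0.99 ≤ y := by rw [hy, le_div_iff₀ hl]; exact h
  rw [Real.rpow_def_of_pos hp, Real.rpow_def_of_pos hp]
  have e1 : Real.log p * -(0.48 / l) = -(0.48 * y) := by rw [hy]; ring
  have e2 : Real.log p * (0.49 / l) = 0.49 * y := by rw [hy]; ring
  rw [e1, e2]
  -- The worst case is y = 0.99, giving exponents 0.99·0.48 = 0.4752 and 0.99·0.49 = 0.4851; then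
  -- 1.622 < 1.624.
  have h1 : Real.exp (-(0.48 * y)) ≤ Real.exp (-0.4752) :=
    Real.exp_le_exp.mpr (by norm_num at hy1 ⊢; linarith)
  have h2 : Real.exp 0.4851 ≤ Real.exp (0.49 * y) :=
    Real.exp_le_exp.mpr (by norm_num at hy1 ⊢; linarith)
  have h3 : (1.608 : ℝ) ≤ Real.exp 0.4752 := by
    have := Real.sum_le_exp_of_nonneg (x := 0.4752) (by norm_num) 6
    refine le_trans ?_ this
    norm_num [Finset.sum_range_succ, Nat.factorial]
  have h4 : (1.6240 : ℝ) ≤ Real.exp 0.4851 := by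
    have := Real.sum_le_exp_of_nonneg (x := 0.4851) (by norm_num) 6
    refine le_trans ?_ this
    norm_num [Finset.sum_range_succ, Nat.factorial]
  have h5 : Real.exp (-0.4752) ≤ 0.6220 := by
    rw [Real.exp_neg]
    refine (inv_anti₀ (by norm_num) h3).trans (by norm_num)
  linarith

/-! ### The total pair count over a set of denominators. -/

/-- The reduced fractions with denominators in `F`, as pairs (denominator, numerator). -/
def fractions (F : Finset ℕ) : Finset (Σ _ : ℕ, ℕ) := F.sigma reducedResidues

theorem card_fractions (F : Finset ℕ) : (fractions F).card = ∑ n ∈ F, n.totient := by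
  simp [fractions, Finset.card_sigma, card_reducedResidues]

theorem card_filter_fractions (F : Finset ℕ) (η : ℝ) :
    (((fractions F ×ˢ fractions F).filter fun q : (Σ _ : ℕ, ℕ) × (Σ _ : ℕ, ℕ) =>
      ‖((q.1.2 / q.1.1 : ℝ) : UnitAddCircle) - ((q.2.2 / q.2.1 : ℝ) : UnitAddCircle)‖ ≤ η).card) =
      ∑ m ∈ F, ∑ n ∈ F, (closePairs m n η).card := by
  classical
  simp only [closePairs, Finset.card_filter, Finset.sum_product, fractions, Finset.sum_sigma]
  refine Finset.sum_congr rfl fun m _ => ?_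
  rw [Finset.sum_comm]

/-- The contribution of the pairs of denominators with small least common multiple. -/
theorem sum_small_lcm_le {F : Finset ℕ} {δ Y s G : ℝ} (hδ : 0 < δ) (hY : 1 ≤ Y) (hs : 0 ≤ s)
    (hs1 : s ≤ 1) (hF : ∀ n ∈ F, 0 < n)
    (hG : ∀ n ∈ F, n * (Y ^ 2 * (δ * n) ^ (-s) * ∑ d ∈ n.divisors, (d : ℝ) ^ (-s)) ≤
      n.totient * G) :
    ∑ m ∈ F, ∑ n ∈ F, (if δ * Nat.lcm m n ≤ Y then δ * m * n else 0) ≤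
      2 * (G * ∑ n ∈ F, (n.totient : ℝ)) := by
  classical
  -- By symmetry only m ≤ n matters; `hG` trades the factor n for φ(n).
  have half : ∑ n ∈ F, ∑ m ∈ F, (if m ≤ n ∧ δ * Nat.lcm m n ≤ Y then δ * m * n else 0) ≤
      G * ∑ n ∈ F, (n.totient : ℝ) := by
    rw [Finset.mul_sum]
    refine Finset.sum_le_sum fun n hn => ?_
    rw [← Finset.sum_filter]
    calc ∑ m ∈ F.filter (fun m => m ≤ n ∧ δ * Nat.lcm m n ≤ Y), δ * (m : ℝ) * n
        ≤ ∑ m ∈ (Finset.Icc 1 n).filter (fun m => δ * Nat.lcm m n ≤ Y), δ * (m : ℝ) * n := by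
          refine Finset.sum_le_sum_of_subset_of_nonneg ?_ fun _ _ _ => by positivity
          intro m hm
          obtain ⟨h1, h2, h3⟩ := Finset.mem_filter.mp hm
          exact Finset.mem_filter.mpr ⟨Finset.mem_Icc.mpr ⟨hF m h1, h2⟩, h3⟩
      _ = n * ∑ m ∈ (Finset.Icc 1 n).filter (fun m => δ * Nat.lcm m n ≤ Y), δ * (m : ℝ) := by
          rw [← Finset.sum_mul, mul_comm]
      _ ≤ _ := mul_le_mul_of_nonneg_left (sum_le_of_lcm_le (hF n hn) hδ hY hs hs1)
          (Nat.cast_nonneg n)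
      _ ≤ _ := hG n hn
      _ = _ := mul_comm _ _
  calc _ ≤ ∑ m ∈ F, ∑ n ∈ F,
        ((if m ≤ n ∧ δ * Nat.lcm m n ≤ Y then δ * (m : ℝ) * n else 0) +
          if n ≤ m ∧ δ * Nat.lcm n m ≤ Y then δ * (n : ℝ) * m else 0) := by
        refine Finset.sum_le_sum fun m _ => Finset.sum_le_sum fun n _ => ?_
        have p1 : 0 ≤ δ * (m : ℝ) * n := by positivity
        have p2 : 0 ≤ δ * (n : ℝ) * m := by positivity
        have e : δ * (n : ℝ) * m = δ * m * n := by ring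
        rw [Nat.lcm_comm n m]
        rcases le_total m n with h | h <;> split_ifs <;> first | linarith | tauto
    _ ≤ _ := by
        simp only [Finset.sum_add_distrib]
        rw [Finset.sum_comm]
        linarith

/-- G bounds both the diagonal and the small-lcm losses, each by a multiple of G∑φ; `hGF` then turns
G∑φ into δ(∑φ)². -/
theorem sum_card_closePairs_le {F : Finset ℕ} {z : ℕ} {K δ s G : ℝ} (hz : 1 ≤ z) (hδ : 0 < δ)
    (hs : 0 ≤ s) (hs1 : s ≤ 1) (hF : ∀ n ∈ F, 0 < n)
    (hK : ∀ n ∈ F, ((n.primeFactors.filter (¬ · ≤ z)).card : ℝ) ≤ K * z)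
    (hG1 : (16 : ℝ) ^ z + 1 ≤ G)
    (hG : ∀ n ∈ F, Real.exp (2 * K) * 4 ^ z * ((16 ^ z) ^ 2 * (δ * n) ^ (-s) *
      ∑ d ∈ n.divisors, (d : ℝ) ^ (-s)) ≤ G)
    (hGF : G ≤ δ * ∑ n ∈ F, (n.totient : ℝ)) :
    ∑ m ∈ F, ∑ n ∈ F, ((closePairs m n (2 * δ)).card : ℝ) ≤
      (8 * Real.exp (2 * K) ^ 2 + 13) * δ * (∑ n ∈ F, (n.totient : ℝ)) ^ 2 := by
  classical
  set E := Real.exp (2 * K) with hE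
  set Φ := ∑ n ∈ F, (n.totient : ℝ) with hΦ
  have hΦ0 : 0 ≤ Φ := Finset.sum_nonneg fun _ _ => Nat.cast_nonneg _
  have hY : (1 : ℝ) ≤ 16 ^ z := one_le_pow₀ (by norm_num)
  have hsmall := sum_small_lcm_le (G := G) hδ hY hs hs1 hF fun n hn => by
    have h0 : 0 ≤ ((16 : ℝ) ^ z) ^ 2 * (δ * n) ^ (-s) * ∑ d ∈ n.divisors, (d : ℝ) ^ (-s) :=
      mul_nonneg (by positivity) (Finset.sum_nonneg fun _ _ => by positivity)
    calc _ ≤ (E * 4 ^ z * n.totient) * _ :=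
          mul_le_mul_of_nonneg_right (le_totient_mul hz (hK n hn)) h0
      _ = n.totient * (E * 4 ^ z * (((16 : ℝ) ^ z) ^ 2 * (δ * n) ^ (-s) *
            ∑ d ∈ n.divisors, (d : ℝ) ^ (-s))) := by ring
      _ ≤ _ := mul_le_mul_of_nonneg_left (hG n hn) (Nat.cast_nonneg _)
  -- The three terms cover large lcm, the diagonal, and distinct denominators with small lcm; the 6
  -- is 3η with η = 2δ.
  have hpt : ∀ m ∈ F, ∀ n ∈ F, ((closePairs m n (2 * δ)).card : ℝ) ≤
      8 * E ^ 2 * δ * (m.totient * n.totient) + (if m = n then n.totient * G else 0) +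
        6 * (if δ * Nat.lcm m n ≤ 16 ^ z then δ * m * n else 0) := by
    intro m hm n hn
    have hG0 : 0 ≤ G := by linarith
    have t1 : 0 ≤ 8 * E ^ 2 * δ * (m.totient * n.totient) := by positivity
    have t2 : (0 : ℝ) ≤ if m = n then n.totient * G else 0 := by split_ifs <;> positivity
    have t3 : (0 : ℝ) ≤ 6 * (if δ * Nat.lcm m n ≤ 16 ^ z then δ * m * n else 0) := by
      split_ifs <;> positivity
    rcases le_or_gt ((16 : ℝ) ^ z) (2 * (2 * δ) * Nat.lcm m n) with h | h
    · have := card_closePairs_le_of_le_lcm hz (hF m hm) (hF n hn) (hK m hm) (hK n hn)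
        (by positivity) h
      have e : 4 * E ^ 2 * (2 * δ) * m.totient * n.totient =
        8 * E ^ 2 * δ * (m.totient * n.totient) := by ring
      rw [← hE, e] at this
      linarith
    · by_cases hmn : m = n
      · subst hmn
        have h1 := card_closePairs_self_le (hF m hm) (η := 2 * δ) (by positivity)
        rw [Nat.lcm_self] at h
        have h2 : (m.totient : ℝ) * (2 * (2 * δ) * m + 1) ≤ m.totient * G := by
          gcongr; linarith
        rw [if_pos rfl] at t2 ⊢
        linarith
      · have h1 := card_closePairs_le_of_ne (hF m hm) (hF n hn) hmn (η := 2 * δ) (by positivity)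
        have h2 : δ * Nat.lcm m n ≤ 16 ^ z := by
          have : 0 ≤ δ * Nat.lcm m n := by positivity
          linarith
        rw [if_pos h2] at t3 ⊢
        linarith
  calc _ ≤ ∑ m ∈ F, ∑ n ∈ F, (8 * E ^ 2 * δ * (m.totient * n.totient) +
        (if m = n then n.totient * G else 0) +
        6 * (if δ * Nat.lcm m n ≤ 16 ^ z then δ * m * n else 0)) :=
        Finset.sum_le_sum fun m hm => Finset.sum_le_sum fun n hn => hpt m hm n hn
    _ = 8 * E ^ 2 * δ * Φ ^ 2 + G * Φ + 6 * ∑ m ∈ F, ∑ n ∈ F,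
        (if δ * Nat.lcm m n ≤ 16 ^ z then δ * (m : ℝ) * n else 0) := by
        simp only [Finset.sum_add_distrib, ← Finset.mul_sum]
        congr 2
        · rw [← Finset.sum_mul]
          ring
        · rw [hΦ, Finset.mul_sum]
          refine Finset.sum_congr rfl fun m hm => ?_
          rw [Finset.sum_ite_eq, if_pos hm, mul_comm]
    -- 13 = 1 for the diagonal + 6·2 for the small-lcm pairs.
    _ ≤ 8 * E ^ 2 * δ * Φ ^ 2 + 13 * (G * Φ) := by linarith
    _ ≤ 8 * E ^ 2 * δ * Φ ^ 2 + 13 * (δ * Φ * Φ) := by gcongr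
    _ = _ := by ring

/-- A measure bound for the neighbourhoods of the fractions with denominators in `F`. -/
theorem volume_neighbourhoods_ge {F : Finset ℕ} {δ C : ℝ} (hδ : 0 < δ) (hδ' : 2 * δ ≤ 1)
    (hC : 0 < C) (hF : ∀ n ∈ F, 0 < n) (hne : F.Nonempty)
    (h : ∑ m ∈ F, ∑ n ∈ F, ((closePairs m n (2 * δ)).card : ℝ) ≤
      C * δ * (∑ n ∈ F, (n.totient : ℝ)) ^ 2) :
    2 / C ≤ (volume : Measure UnitAddCircle).real
      (⋃ n ∈ F, ⋃ a ∈ reducedResidues n, Metric.closedBall ((a / n : ℝ) : UnitAddCircle) δ) := by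
  have hcard := card_fractions F
  have hI : (fractions F).Nonempty := by
    obtain ⟨n, hn⟩ := hne
    rw [← Finset.card_pos, hcard]
    exact Finset.sum_pos (fun n hn => Nat.totient_pos.mpr (hF n hn)) ⟨n, hn⟩
  have h1 := volume_biUnion_closedBall_ge (fractions F)
    (fun i => ((i.2 / i.1 : ℝ) : UnitAddCircle)) hδ hδ' hC hI (by
      rw [card_filter_fractions, hcard]; exact_mod_cast h)
  refine h1.trans (measureReal_mono ?_ (measure_ne_top _ _))
  refine Set.iUnion₂_subset fun i hi => ?_
  obtain ⟨hi1, hi2⟩ := Finset.mem_sigma.mp hi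
  exact fun y hy => Set.mem_biUnion hi1 (Set.mem_biUnion hi2 hy)

/-! ### Numerical budget for a block and its measure. -/

theorem eventually_growth (A : ℝ) : ∀ᶠ j : ℕ in atTop, 500 ≤ Real.log j ∧
    Real.log j ≤ (j : ℝ) ^ (0.001 : ℝ) ∧ A ≤ (j : ℝ) ^ (0.008 : ℝ) := by
  have hc : Tendsto (fun j : ℕ => (j : ℝ)) atTop atTop := tendsto_natCast_atTop_atTop
  have h1 := (Real.tendsto_log_atTop.comp hc).eventually_ge_atTop 500
  have h2 := hc.eventually ((isLittleO_log_rpow_atTop (show (0 : ℝ) < 0.001 by norm_num)).bound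
    one_pos)
  have h3 := ((tendsto_rpow_atTop (show (0 : ℝ) < 0.008 by norm_num)).comp hc).eventually_ge_atTop A
  filter_upwards [h1, h2, h3] with j h1 h2 h3
  refine ⟨h1, ?_, h3⟩
  rw [one_mul, Real.norm_eq_abs, Real.norm_eq_abs] at h2
  exact (le_abs_self _).trans (h2.trans (abs_of_nonneg (by positivity)).le)

/-- The size of the gain available in the block with index `j`. -/
noncomputable def blockGain (j : ℕ) : ℝ :=
  Real.exp (j / (2 * Real.log (j + 1))) / (Real.exp 1 * j ^ 2)

/-- In units of j / log j the budget is 0.0007 + 0.495, plus 0.001 for all lower-order terms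
including the denominator of `blockGain`, against 0.499. -/
theorem exp_le_blockGain {j : ℕ} {K : ℝ} (hK : 0 ≤ K) (hl : 500 ≤ Real.log j)
    (hlr : Real.log j ≤ (j : ℝ) ^ (0.001 : ℝ))
    (hA : 1000 * (2 * K + 6) ≤ (j : ℝ) ^ (0.008 : ℝ)) :
    Real.exp (2 * K + 0.0007 * (j / Real.log j) + 0.495 * ((j + 1) / Real.log j) +
      (j : ℝ) ^ (0.99 : ℝ) * Real.log (4 * (j + 1))) ≤ blockGain j := by
  set l := Real.log j with hl_def
  have hj0 : (0 : ℝ) < j := by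
    rcases Nat.eq_zero_or_pos j with h | h
    · rw [hl_def, h] at hl; norm_num at hl
    · exact_mod_cast h
  have hj1 : (1 : ℝ) ≤ j := by exact_mod_cast Nat.cast_pos.mp hj0
  have hl0 : 0 < l := by linarith
  have hlog1 : Real.log (j + 1) ≤ l + 1 := by
    calc Real.log (j + 1) ≤ Real.log (2 * j) := Real.log_le_log (by linarith) (by linarith)
      _ = Real.log 2 + l := Real.log_mul (by norm_num) hj0.ne'
      _ ≤ l + 1 := by linarith [Real.log_two_lt_d9]
  have hlog4 : Real.log (4 * (j + 1)) ≤ 2 * l := by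
    calc Real.log (4 * (j + 1)) = Real.log 4 + Real.log (j + 1) :=
          Real.log_mul (by norm_num) (by linarith)
      _ ≤ 3 + (l + 1) := by
          have := Real.log_le_sub_one_of_pos (show (0 : ℝ) < 4 by norm_num)
          linarith
      _ ≤ 2 * l := by linarith
  have hl1pos : 0 < Real.log (j + 1) := Real.log_pos (by linarith)
  -- This is where 500 ≤ l enters: 0.998(l + 1) ≤ l requires l ≥ 499.
  have e3 : 0.499 * (j / l) ≤ j / (2 * Real.log (j + 1)) := by
    rw [mul_div_assoc', div_le_div_iff₀ hl0 (by positivity)]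
    have : 0.499 * (2 * Real.log (j + 1)) ≤ l := by norm_num at *; linarith
    nlinarith
  set r : ℝ := (j : ℝ) ^ (0.992 : ℝ) with hr
  have r1 : l * l * (j : ℝ) ^ (0.99 : ℝ) ≤ r := by
    have : r = (j : ℝ) ^ (0.001 : ℝ) * (j : ℝ) ^ (0.001 : ℝ) * (j : ℝ) ^ (0.99 : ℝ) := by
      rw [hr, ← Real.rpow_add hj0, ← Real.rpow_add hj0]; norm_num
    rw [this]
    gcongr
  have r0 : (1 : ℝ) ≤ (j : ℝ) ^ (0.99 : ℝ) := Real.one_le_rpow hj1 (by norm_num)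
  have r2 : l * l ≤ r := le_trans (le_mul_of_one_le_right (by positivity) r0) r1
  have r3 : l ≤ r := by nlinarith
  have r4 : 1000 * (2 * K + 6) * r ≤ j := by
    have : (j : ℝ) = (j : ℝ) ^ (0.008 : ℝ) * r := by
      rw [hr, ← Real.rpow_add hj0]; norm_num
    calc _ ≤ (j : ℝ) ^ (0.008 : ℝ) * r := by gcongr
      _ = j := this.symm
  have e2 : 2 * K + 2 + 2 * l + (j : ℝ) ^ (0.99 : ℝ) * (2 * l) ≤ 0.001 * (j / l) := by
    rw [mul_div_assoc', le_div_iff₀ hl0]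
    have h1 : (2 * K + 2) * l ≤ (2 * K + 2) * r := by gcongr
    norm_num
    nlinarith
  have e5 : (j : ℝ) ^ (0.99 : ℝ) * Real.log (4 * (j + 1)) ≤ (j : ℝ) ^ (0.99 : ℝ) * (2 * l) := by
    gcongr
  have e6 : 0.495 * ((j + 1) / l) ≤ 0.495 * (j / l) + 1 := by
    rw [add_div]
    have : 1 / l ≤ 1 := by rw [div_le_one hl0]; linarith
    linarith
  have e7 : 0 ≤ (j : ℝ) / l := by positivity
  rw [blockGain, le_div_iff₀ (by positivity)]
  have e8 : (j : ℝ) ^ 2 = Real.exp (2 * l) := by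
    rw [two_mul, Real.exp_add, hl_def, Real.exp_log hj0, sq]
  rw [e8, ← Real.exp_add, ← Real.exp_add, Real.exp_le_exp]
  norm_num at *
  linarith

/-- With s = 0.48/log j and t = 0.49/log j, δ^(-s) contributes 0.48 and n^(t-s) at most 0.01·1.5 to
the coefficient 0.495. Primes up to j^0.99 give the second, lower-order term. -/
theorem block_divisor_sum_le {j n : ℕ} (hl : 500 ≤ Real.log j) (hn0 : 0 < n)
    (hnlog : Real.log n ≤ 1.5 * (j + 1)) :
    (Real.exp (-(j + 1)) * n) ^ (-(0.48 / Real.log j)) *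
      ∑ d ∈ n.divisors, (d : ℝ) ^ (-(0.48 / Real.log j)) ≤
    Real.exp (0.495 * ((j + 1) / Real.log j) +
      (j : ℝ) ^ (0.99 : ℝ) * Real.log (4 * (j + 1))) := by
  set l := Real.log j with hl_def
  have hj0 : (0 : ℝ) < j := by
    rcases Nat.eq_zero_or_pos j with h | h
    · rw [hl_def, h] at hl; norm_num at hl
    · exact_mod_cast h
  have hj1 : (1 : ℝ) ≤ j := by exact_mod_cast Nat.cast_pos.mp hj0
  have hl0 : 0 < l := by linarith
  have hnr : (0 : ℝ) < n := by exact_mod_cast hn0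
  have hs0 : 0 ≤ 0.48 / l := by positivity
  set H3 : ℝ := 0.495 * ((j + 1) / l) with hH3
  set H4 : ℝ := (j : ℝ) ^ (0.99 : ℝ) * Real.log (4 * (j + 1)) with hH4
  set δ : ℝ := Real.exp (-(j + 1)) with hδ
  have hδ0 : 0 < δ := Real.exp_pos _
  have hX : (Nat.log 2 n + 1 : ℝ) ≤ 4 * (j + 1) := by
    have h1 : (Nat.log 2 n : ℝ) * Real.log 2 ≤ Real.log n := by
      rw [← Real.log_pow]
      refine Real.log_le_log (by positivity) ?_
      exact_mod_cast Nat.pow_log_le_self 2 hn0.ne'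
    have h2 := Real.log_two_gt_d9
    have h3 : (0 : ℝ) ≤ Nat.log 2 n := Nat.cast_nonneg _
    norm_num at *
    nlinarith
  have hdiv := sum_divisors_rpow_le (z := ⌊(j : ℝ) ^ (0.99 : ℝ)⌋₊) (t := 0.49 / l) hs0
    (by positivity) hX (fun p hp hzp => by
      have hp0 : (0 : ℝ) < p := by exact_mod_cast hp.pos
      refine one_add_rpow_neg_le hl0 hp0 ?_
      rw [← Real.log_rpow hj0]
      exact Real.log_le_log (by positivity) (Nat.lt_of_floor_lt hzp).le) hn0 le_rfl
  have hXpow : (4 * ((j : ℝ) + 1)) ^ ⌊(j : ℝ) ^ (0.99 : ℝ)⌋₊ ≤ Real.exp H4 := by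
    rw [← Real.rpow_natCast, Real.rpow_def_of_pos (by positivity), Real.exp_le_exp, hH4, mul_comm]
    exact mul_le_mul_of_nonneg_right (Nat.floor_le (by positivity))
      (Real.log_nonneg (by linarith))
  have hnp : (δ * n) ^ (-(0.48 / l)) * (n : ℝ) ^ (0.49 / l) ≤ Real.exp H3 := by
    rw [Real.mul_rpow hδ0.le hnr.le, mul_assoc, ← Real.rpow_add hnr, Real.rpow_def_of_pos hδ0,
      Real.rpow_def_of_pos hnr, ← Real.exp_add, Real.exp_le_exp, hδ, Real.log_exp, hH3]
    have h1 : Real.log n * (-(0.48 / l) + 0.49 / l) = 0.01 * (Real.log n / l) := by ring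
    have h2 : Real.log n / l ≤ 1.5 * (j + 1) / l := by gcongr
    have h3 : -((j : ℝ) + 1) * -(0.48 / l) = 0.48 * ((j + 1) / l) := by ring
    have h4 : 1.5 * ((j : ℝ) + 1) / l = 1.5 * ((j + 1) / l) := by ring
    rw [h1, h3]
    rw [h4] at h2
    norm_num at *
    linarith
  calc _ ≤ (δ * n) ^ (-(0.48 / l)) * ((n : ℝ) ^ (0.49 / l) *
        (4 * ((j : ℝ) + 1)) ^ ⌊(j : ℝ) ^ (0.99 : ℝ)⌋₊) :=
        mul_le_mul_of_nonneg_left hdiv (by positivity)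
    _ = (δ * n) ^ (-(0.48 / l)) * (n : ℝ) ^ (0.49 / l) *
        (4 * ((j : ℝ) + 1)) ^ ⌊(j : ℝ) ^ (0.99 : ℝ)⌋₊ := (mul_assoc _ _ _).symm
    _ ≤ Real.exp H3 * Real.exp H4 :=
        mul_le_mul hnp hXpow (by positivity) (Real.exp_pos _).le
    _ = _ := (Real.exp_add _ _).symm

theorem volume_block_ge : ∃ c : ℝ, 0 < c ∧ ∃ J : ℕ, ∀ j : ℕ, J ≤ j → ∀ F : Finset ℕ, F.Nonempty →
    (∀ n ∈ F, 0 < n ∧ Real.log n ≤ 1.5 * (j + 1)) →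
    blockGain j ≤ Real.exp (-(j + 1)) * ∑ n ∈ F, (n.totient : ℝ) →
    c ≤ (volume : Measure UnitAddCircle).real (⋃ n ∈ F, ⋃ a ∈ reducedResidues n,
      Metric.closedBall ((a / n : ℝ) : UnitAddCircle) (Real.exp (-(j + 1)))) := by
  -- Chosen so that K·0.00005·(j/l)·(l/2) = 3j ≥ 1.5(j + 1), which bounds the number of prime
  -- factors above z.
  set K : ℝ := 120000 with hK
  refine ⟨2 / (8 * Real.exp (2 * K) ^ 2 + 13), by positivity, ?_⟩
  obtain ⟨J, hJ⟩ := eventually_atTop.mp (eventually_growth (1000 * (2 * K + 6)))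
  refine ⟨J, fun j hj F hne hF hgain => ?_⟩
  obtain ⟨hl, hlr, hA⟩ := hJ j hj
  have hmain := exp_le_blockGain (K := K) (by norm_num [hK]) hl hlr hA
  set l := Real.log j with hl_def
  have hj0 : (0 : ℝ) < j := by
    rcases Nat.eq_zero_or_pos j with h | h
    · rw [hl_def, h] at hl; norm_num at hl
    · exact_mod_cast h
  have hj1 : (1 : ℝ) ≤ j := by exact_mod_cast Nat.cast_pos.mp hj0
  have hl0 : 0 < l := by linarith
  -- Large enough that n has O(z) prime factors above z, small enough that 1024^z ≤ exp(0.0007 j/l).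
  -- Here 1024 = 4·16² combines the loss n/φ(n) with Y² for Y = 16^z.
  set z := ⌊0.0001 * (j / l)⌋₊ with hz
  have hzle : (z : ℝ) ≤ 0.0001 * (j / l) := Nat.floor_le (by positivity)
  have hbig : 2 * (j : ℝ) ^ (0.5 : ℝ) ≤ 0.0001 * (j / l) := by
    rw [mul_div_assoc', le_div_iff₀ hl0]
    have h1 : (j : ℝ) ^ (0.5 : ℝ) * l ≤ (j : ℝ) ^ (0.992 : ℝ) := by
      calc _ ≤ (j : ℝ) ^ (0.5 : ℝ) * (j : ℝ) ^ (0.001 : ℝ) := by gcongr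
        _ = (j : ℝ) ^ (0.501 : ℝ) := by rw [← Real.rpow_add hj0]; norm_num
        _ ≤ _ := Real.rpow_le_rpow_of_exponent_le hj1 (by norm_num)
    have h2 : (j : ℝ) = (j : ℝ) ^ (0.008 : ℝ) * (j : ℝ) ^ (0.992 : ℝ) := by
      rw [← Real.rpow_add hj0]; norm_num
    have h3 : 1000 * (2 * K + 6) * (j : ℝ) ^ (0.992 : ℝ) ≤ j := by
      calc _ ≤ (j : ℝ) ^ (0.008 : ℝ) * (j : ℝ) ^ (0.992 : ℝ) := by gcongr
        _ = j := h2.symm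
    rw [hK] at h3
    have h4 : 0 ≤ (j : ℝ) ^ (0.992 : ℝ) := by positivity
    norm_num at *
    linarith
  have hsq1 : (1 : ℝ) ≤ (j : ℝ) ^ (0.5 : ℝ) := Real.one_le_rpow hj1 (by norm_num)
  have hzgt : 0.0001 * (j / l) < z + 1 := Nat.lt_floor_add_one _
  have hzhalf : 0.00005 * (j / l) ≤ z := by norm_num at *; linarith
  have hzsq : (j : ℝ) ^ (0.5 : ℝ) ≤ z := by norm_num at *; linarith
  have hz1 : 1 ≤ z := by exact_mod_cast hsq1.trans hzsq
  have hlogz : l / 2 ≤ Real.log z := by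
    calc l / 2 = Real.log ((j : ℝ) ^ (0.5 : ℝ)) := by rw [Real.log_rpow hj0]; norm_num; ring
      _ ≤ _ := Real.log_le_log (by positivity) hzsq
  have hKF : ∀ n ∈ F, ((n.primeFactors.filter (¬ · ≤ z)).card : ℝ) ≤ K * z := by
    intro n hn
    have h1 := (card_large_primeFactors_mul_log_le hz1 (hF n hn).1).trans (hF n hn).2
    have h2 : 1.5 * ((j : ℝ) + 1) ≤ K * z * Real.log z := by
      calc 1.5 * ((j : ℝ) + 1) ≤ K * (0.00005 * (j / l)) * (l / 2) := by
            have : K * (0.00005 * (j / l)) * (l / 2) = 3 * j := by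
              rw [hK]; field_simp; norm_num
            rw [this]; norm_num; linarith
        _ ≤ _ := by gcongr
    exact le_of_mul_le_mul_right (h1.trans h2) (by linarith)
  have hpow : ∀ (b : ℝ), 1 ≤ b → b ≤ 1024 → b ^ z ≤ Real.exp (0.0007 * (j / l)) := by
    intro b hb hb2
    have h7 : (1024 : ℝ) ≤ Real.exp 7 := by
      have := Real.exp_one_gt_d9
      calc (1024 : ℝ) ≤ 2.71 ^ 7 := by norm_num
        _ ≤ Real.exp 1 ^ 7 := by gcongr; linarith
        _ = Real.exp 7 := by rw [← Real.exp_nat_mul]; norm_num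
    calc b ^ z ≤ Real.exp 7 ^ z := by gcongr; linarith
      _ = Real.exp (z * 7) := by rw [← Real.exp_nat_mul]
      _ ≤ _ := by rw [Real.exp_le_exp]; norm_num at *; linarith
  have hE2 : 2 ≤ Real.exp (2 * K) := by
    have := Real.add_one_le_exp (2 * K)
    rw [hK] at this ⊢
    linarith
  set H3 : ℝ := 0.495 * ((j + 1) / l) with hH3
  set H4 : ℝ := (j : ℝ) ^ (0.99 : ℝ) * Real.log (4 * (j + 1)) with hH4
  have hH3' : 0 ≤ H3 := by positivity
  have hH4' : 0 ≤ H4 := mul_nonneg (by positivity) (Real.log_nonneg (by linarith))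
  have hs0 : 0 ≤ 0.48 / l := by positivity
  have hs1 : 0.48 / l ≤ 1 := by rw [div_le_one hl0]; norm_num; linarith
  have hG1 : (16 : ℝ) ^ z + 1 ≤ blockGain j := by
    have h1 := hpow 16 (by norm_num) (by norm_num)
    have h2 : (1 : ℝ) ≤ 16 ^ z := one_le_pow₀ (by norm_num)
    calc (16 : ℝ) ^ z + 1 ≤ 2 * Real.exp (0.0007 * (j / l)) := by linarith
      _ ≤ Real.exp (2 * K) * Real.exp (0.0007 * (j / l)) := by gcongr
      _ = Real.exp (2 * K + 0.0007 * (j / l)) := (Real.exp_add _ _).symm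
      _ ≤ _ := Real.exp_le_exp.mpr (by linarith)
      _ ≤ _ := hmain
  set δ : ℝ := Real.exp (-(j + 1)) with hδ
  have hδ0 : 0 < δ := Real.exp_pos _
  have hδ' : 2 * δ ≤ 1 := by
    rw [hδ, Real.exp_neg, ← div_eq_mul_inv, div_le_one (Real.exp_pos _)]
    have := Real.add_one_le_exp ((j : ℝ) + 1)
    linarith
  have hG : ∀ n ∈ F, Real.exp (2 * K) * 4 ^ z * ((16 ^ z) ^ 2 * (δ * n) ^ (-(0.48 / l)) *
      ∑ d ∈ n.divisors, (d : ℝ) ^ (-(0.48 / l))) ≤ blockGain j := by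
    intro n hn
    obtain ⟨hn0, hnlog⟩ := hF n hn
    have hn := block_divisor_sum_le hl hn0 hnlog
    have h1024 : (4 : ℝ) ^ z * ((16 : ℝ) ^ z) ^ 2 = 1024 ^ z := by
      rw [← pow_mul, mul_comm z 2, pow_mul, ← mul_pow]; norm_num
    have h1 := hpow 1024 (by norm_num) le_rfl
    have h2 := mul_le_mul h1 hn (mul_nonneg (by positivity)
      (Finset.sum_nonneg fun _ _ => by positivity)) (Real.exp_pos _).le
    refine le_trans (le_trans (le_of_eq ?_)
      (mul_le_mul_of_nonneg_left h2 (Real.exp_pos (2 * K)).le)) (le_trans (le_of_eq ?_) hmain)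
    · rw [← h1024]; ring
    · rw [← Real.exp_add, ← Real.exp_add]; congr 1; ring
  exact volume_neighbourhoods_ge hδ0 hδ' (by positivity) (fun n hn => (hF n hn).1) hne
    (sum_card_closePairs_le hz1 hδ0 hs0 hs1 (fun n hn => (hF n hn).1) hKF hG1 hG hgain)

/-! ### Reduction by the zero-one law. -/

/-- The radii `ψ n / n`, truncated at `n ^ (-2/3)`. -/
noncomputable def truncatedRadius (ψ : ℕ → ℝ) (n : ℕ) : ℝ :=
  min (ψ n / n) ((n : ℝ) ^ (-(2 / 3) : ℝ))

/-- The zero-one law used below asks for radii tending to 0; the truncation ensures this for every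
nonnegative ψ. -/
theorem tendsto_truncatedRadius {ψ : ℕ → ℝ} (hψ : ∀ n : ℕ, 1 ≤ n → 0 ≤ ψ n) :
    Tendsto (truncatedRadius ψ) atTop (𝓝 0) := by
  have h1 : Tendsto (fun n : ℕ => (n : ℝ) ^ (-(2 / 3) : ℝ)) atTop (𝓝 0) :=
    (tendsto_rpow_neg_atTop (by norm_num)).comp tendsto_natCast_atTop_atTop
  refine tendsto_of_tendsto_of_tendsto_of_le_of_le' tendsto_const_nhds h1 ?_
    (Eventually.of_forall fun n => min_le_right _ _)
  filter_upwards [eventually_ge_atTop 1] with n hn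
  exact le_min (div_nonneg (hψ n hn) (Nat.cast_nonneg n)) (by positivity)

theorem approxAddOrderOf_subset_approxSet (ψ : ℕ → ℝ) {n : ℕ} (hn : 0 < n) :
    approxAddOrderOf UnitAddCircle n (truncatedRadius ψ n) ⊆ approxSet ψ n := by
  intro x hx
  obtain ⟨m, hm, hgcd, hx⟩ := (UnitAddCircle.mem_approxAddOrderOf_iff hn).mp hx
  replace hx := lt_of_lt_of_le hx (min_le_left _ _)
  obtain ⟨y, rfl⟩ := QuotientAddGroup.mk_surjective x
  change ‖((y : ℝ) : UnitAddCircle) - _‖ < _ at hx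
  rw [← AddCircle.coe_sub, UnitAddCircle.norm_eq] at hx
  set k := round (y - (m : ℝ) / n)
  have hn0 : (0 : ℝ) < n := by exact_mod_cast hn
  have period : ∀ i : ℤ, ((y + i : ℝ) : UnitAddCircle) = (y : UnitAddCircle) := fun i => by
    rw [AddCircle.coe_add, add_eq_left, AddCircle.coe_eq_zero_iff]
    exact ⟨i, by simp⟩
  obtain ⟨h1, h2⟩ := abs_lt.mp hx
  -- Numerators here run over 0 ≤ m < n, but over 1 ≤ a ≤ n in `approxSet`. They differ only when n
  -- = 1, where 0 is replaced by 1.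
  rcases Nat.eq_zero_or_pos m with rfl | hm0
  · have hn1 : n = 1 := by simpa using hgcd
    subst hn1
    refine Set.mem_biUnion (x := 1) ⟨le_rfl, le_rfl, Nat.coprime_one_left 1⟩
      ⟨y + (1 - k : ℤ), ?_, period _⟩
    push_cast at h1 h2 ⊢
    constructor <;> linarith
  · refine Set.mem_biUnion (x := m) ⟨hm0, hm.le, hgcd⟩ ⟨y + (-k : ℤ), ?_, period _⟩
    push_cast
    rw [sub_div, add_div]
    constructor <;> linarith

theorem closedBall_subset_approxAddOrderOf {n a : ℕ} (hn : 0 < n) (ha : a ∈ reducedResidues n)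
    {r δ : ℝ} (hr : r < δ) : Metric.closedBall ((a / n : ℝ) : UnitAddCircle) r ⊆
      approxAddOrderOf UnitAddCircle n δ := by
  intro x hx
  obtain ⟨h1, h2⟩ := Finset.mem_filter.mp ha
  rw [mem_closedBall_iff_norm] at hx
  exact (UnitAddCircle.mem_approxAddOrderOf_iff hn).mpr
    ⟨a, Finset.mem_range.mp h1, Nat.coprime_comm.mp h2, hx.trans_lt hr⟩

/-- By Gallagher's zero-one law, it is enough to bound from below the measure of the tails. -/
theorem volume_W_eq_one {ψ : ℕ → ℝ} (hψ : ∀ n : ℕ, 1 ≤ n → 0 ≤ ψ n) {c : ℝ} (hc : 0 < c)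
    (h : ∀ N, c ≤ (volume : Measure UnitAddCircle).real
      (⋃ n ∈ {n | N ≤ n}, approxAddOrderOf UnitAddCircle n (truncatedRadius ψ n))) :
    volume (W ψ) = 1 := by
  set E : ℕ → Set UnitAddCircle := fun n =>
    approxAddOrderOf UnitAddCircle n (truncatedRadius ψ n) with hE
  have hmem : ∀ x, x ∈ addWellApproximable UnitAddCircle (truncatedRadius ψ) ↔
      {n | 0 < n ∧ x ∈ E n}.Infinite := by
    intro x
    rw [mem_add_wellApproximable_iff, ← Nat.cofinite_eq_atTop, cofinite.blimsup_set_eq]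
    rfl
  have hlow := measure_limsup_ge (volume : Measure UnitAddCircle) E
    (fun n => Metric.isOpen_thickening.measurableSet) h
  have hsub : (⋂ N, ⋃ n ∈ {n | N ≤ n}, E n) ⊆
      addWellApproximable UnitAddCircle (truncatedRadius ψ) := by
    intro x hx
    rw [hmem, Set.infinite_iff_exists_gt]
    intro N
    obtain ⟨n, hn, hxn⟩ := Set.mem_iUnion₂.mp (Set.mem_iInter.mp hx (N + 1))
    have hn' : N + 1 ≤ n := hn
    exact ⟨n, ⟨by omega, hxn⟩, by omega⟩
  have hae : ∀ᵐ x, x ∈ addWellApproximable UnitAddCircle (truncatedRadius ψ) := by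
    refine (AddCircle.addWellApproximable_ae_empty_or_univ (truncatedRadius ψ)
      (tendsto_truncatedRadius hψ)).resolve_left fun h0 => ?_
    have h1 : volume (addWellApproximable UnitAddCircle (truncatedRadius ψ)) = 0 :=
      measure_eq_zero_iff_ae_notMem.mpr h0
    have h2 := measureReal_def (volume : Measure UnitAddCircle) (⋂ N, ⋃ n ∈ {n | N ≤ n}, E n)
    rw [measure_mono_null hsub h1, ENNReal.toReal_zero] at h2
    linarith
  have hW : addWellApproximable UnitAddCircle (truncatedRadius ψ) ⊆ W ψ := by
    intro x hx
    rw [hmem, Set.infinite_iff_exists_gt] at hx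
    refine Set.mem_iInter₂.mpr fun N _ => ?_
    obtain ⟨n, ⟨hn0, hxn⟩, hNn⟩ := hx N
    exact Set.mem_biUnion (x := n) hNn.le (approxAddOrderOf_subset_approxSet ψ hn0 hxn)
  have h3 : ∀ᵐ x, x ∈ W ψ := hae.mono fun x hx => hW hx
  have h4 : W ψ =ᵐ[volume] Set.univ := eventuallyEq_univ.mpr h3
  rw [measure_congr h4, UnitAddCircle.measure_univ]

/-! ### One denominator with a large radius. -/

/-- A single denominator with a large radius already gives a set of positive measure. -/
theorem volume_single_ge : ∃ c : ℝ, 0 < c ∧ ∀ᶠ n : ℕ in atTop,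
    c ≤ (volume : Measure UnitAddCircle).real (⋃ m ∈ ({n} : Finset ℕ), ⋃ a ∈ reducedResidues m,
      Metric.closedBall ((a / m : ℝ) : UnitAddCircle) ((n : ℝ) ^ (-(2 / 3) : ℝ) / 2)) := by
  refine ⟨2 / (8 * Real.exp (2 * 200) ^ 2), by positivity, ?_⟩
  have hlog := (Real.tendsto_log_atTop.comp tendsto_natCast_atTop_atTop).eventually_ge_atTop
    (600 : ℝ)
  filter_upwards [hlog, eventually_ge_atTop 1] with n hl hn
  simp only [Function.comp_apply] at hl
  have hn0 : (0 : ℝ) < n := by exact_mod_cast hn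
  have hn1 : (1 : ℝ) ≤ n := by exact_mod_cast hn
  -- Then 16^z ≤ e^(3z) ≤ n^(1/3) = ηn, while n has at most log n ≤ 200z prime factors above z.
  set z := ⌊Real.log n / 100⌋₊ with hz
  have hz1 : (z : ℝ) ≤ Real.log n / 100 := Nat.floor_le (by linarith)
  have hz2 : Real.log n / 100 < z + 1 := Nat.lt_floor_add_one _
  have hz3 : (3 : ℝ) ≤ z := by
    have : 3 ≤ z := Nat.le_floor (by push_cast; linarith)
    exact_mod_cast this
  have hz4 : 1 ≤ z := by exact_mod_cast (by linarith : (1 : ℝ) ≤ z)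
  have hlogz : 1 ≤ Real.log z := by
    rw [Real.le_log_iff_exp_le (by linarith)]
    linarith [Real.exp_one_lt_d9]
  have hK : ((n.primeFactors.filter (¬ · ≤ z)).card : ℝ) ≤ 200 * z := by
    have h1 := card_large_primeFactors_mul_log_le hz4 hn
    have h2 : (0 : ℝ) ≤ (n.primeFactors.filter (¬ · ≤ z)).card := Nat.cast_nonneg _
    nlinarith
  set η : ℝ := (n : ℝ) ^ (-(2 / 3) : ℝ) with hη
  have hη0 : 0 < η := by positivity
  have hη1 : η ≤ 1 := Real.rpow_le_one_of_one_le_of_nonpos hn1 (by norm_num)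
  have h16 : (16 : ℝ) ^ z ≤ 2 * η * Nat.lcm n n := by
    have e1 : η * n = (n : ℝ) ^ (1 / 3 : ℝ) := by
      rw [hη, ← Real.rpow_add_one hn0.ne']; norm_num
    have h3 : (16 : ℝ) ≤ Real.exp 3 := by
      calc (16 : ℝ) ≤ 2.7 ^ 3 := by norm_num
        _ ≤ Real.exp 1 ^ 3 := by gcongr; linarith [Real.exp_one_gt_d9]
        _ = Real.exp 3 := by rw [← Real.exp_nat_mul]; norm_num
    have h4 : (16 : ℝ) ^ z ≤ (n : ℝ) ^ (1 / 3 : ℝ) := by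
      calc (16 : ℝ) ^ z ≤ Real.exp 3 ^ z := by gcongr
        _ = Real.exp (z * 3) := by rw [← Real.exp_nat_mul]
        _ ≤ Real.exp (Real.log n * (1 / 3)) := by rw [Real.exp_le_exp]; linarith
        _ = _ := (Real.rpow_def_of_pos hn0 _).symm
    have h5 : 0 ≤ (n : ℝ) ^ (1 / 3 : ℝ) := by positivity
    rw [Nat.lcm_self, mul_assoc, e1]
    linarith
  have hpairs := card_closePairs_le_of_le_lcm hz4 hn hn hK hK hη0.le h16
  refine volume_neighbourhoods_ge (by positivity) (by linarith) (by positivity) ?_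
    (Finset.singleton_nonempty n) ?_
  · simpa using Nat.pos_of_ne_zero (Nat.one_le_iff_ne_zero.mp hn)
  · rw [Finset.sum_singleton, Finset.sum_singleton, Finset.sum_singleton,
      mul_div_cancel₀ _ two_ne_zero]
    calc _ ≤ _ := hpairs
      _ = _ := by ring

/-! ### Dyadic-type blocks and divergence. -/

/-- The denominators `n ≥ N` for which `ψ n / n` lies in `(e ^ (-(j + 1)), e ^ (-j)]`. -/
noncomputable def block (ψ : ℕ → ℝ) (N j : ℕ) : Finset ℕ :=
  (Finset.Icc N ⌊Real.exp (1.5 * (j + 1))⌋₊).filter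
    fun n => Real.exp (-(j + 1)) < ψ n / n ∧ ψ n / n ≤ Real.exp (-j)

/-- The cutoff in `block` excludes nothing when ψ(n) < n^(1/3): e^(-(j+1)) < n^(-2/3) gives n <
e^(1.5(j+1)). -/
theorem mem_block {ψ : ℕ → ℝ} {N j n : ℕ} (hN : 1 ≤ N) (hn : N ≤ n)
    (hψn : ψ n < (n : ℝ) ^ (1 / 3 : ℝ)) (h1 : Real.exp (-(j + 1)) < ψ n / n)
    (h2 : ψ n / n ≤ Real.exp (-j)) : n ∈ block ψ N j := by
  have hn0 : (0 : ℝ) < n := by exact_mod_cast hN.trans hn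
  refine Finset.mem_filter.mpr ⟨Finset.mem_Icc.mpr ⟨hn, Nat.le_floor ?_⟩, h1, h2⟩
  have h3 : ψ n / n < (n : ℝ) ^ (-(2 / 3) : ℝ) := by
    rw [div_lt_iff₀ hn0, ← Real.rpow_add_one hn0.ne']
    norm_num at hψn ⊢
    exact hψn
  have h4 := h1.trans h3
  rw [Real.rpow_def_of_pos hn0, Real.exp_lt_exp] at h4
  rw [← Real.log_le_iff_le_exp hn0]
  norm_num at h4 ⊢
  linarith

/-- Here j ≤ -log x ≤ j + 1, and j ≥ 2 keeps log(-log x) positive, away from the exceptional point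
1/e. -/
theorem f_le {x : ℝ} {j : ℕ} (hj : 2 ≤ j) (h1 : Real.exp (-(j + 1)) < x)
    (h2 : x ≤ Real.exp (-j)) : f x ≤ Real.exp (-j) * Real.exp (-(j / (2 * Real.log (j + 1)))) := by
  have hj2 : (2 : ℝ) ≤ j := by exact_mod_cast hj
  have hx0 : 0 < x := (Real.exp_pos _).trans h1
  have hx1 : x < 1 := h2.trans_lt (by rw [Real.exp_lt_one_iff]; linarith)
  have hL1 : (j : ℝ) ≤ -Real.log x := by
    have := Real.log_le_log hx0 h2
    rw [Real.log_exp] at this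
    linarith
  have hL2 : -Real.log x ≤ j + 1 := by
    have := Real.log_le_log (Real.exp_pos _) h1.le
    rw [Real.log_exp] at this
    linarith
  rw [f, if_neg (not_le.mpr hx0), if_pos hx1]
  set L := -Real.log x with hL
  have hlog : 0 < Real.log L := Real.log_pos (by linarith)
  have e : Real.log x = -L := by rw [hL, neg_neg]
  rw [e, neg_div]
  have hL0 : 0 < L := by linarith
  gcongr

theorem exists_block {ψ : ℕ → ℝ}
    (hdiv : Tendsto (fun N : ℕ => ∑ n ∈ Finset.Icc 1 N, f (ψ n / (n : ℝ)) * (Nat.totient n : ℝ))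
      atTop atTop) {N : ℕ} (hN : 1 ≤ N) (hsmall : ∀ n, N ≤ n → ψ n < (n : ℝ) ^ (1 / 3 : ℝ))
    (J : ℕ) : ∃ j, J ≤ j ∧ 2 ≤ j ∧
      blockGain j ≤ Real.exp (-(j + 1)) * ∑ n ∈ block ψ N j, (n.totient : ℝ) := by
  classical
  by_contra! hcon
  set J' := max J 2 with hJ'
  obtain ⟨N₂, hN₂⟩ := eventually_atTop.mp
    ((Real.tendsto_log_atTop.comp tendsto_natCast_atTop_atTop).eventually_ge_atTop
      (2 * (J' : ℝ)))
  set M := max N N₂ with hM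
  have hsum : Summable fun j : ℕ => 1 / (j : ℝ) ^ 2 :=
    Real.summable_one_div_nat_pow.mpr (by norm_num)
  set u : ℕ → ℝ := fun n => f (ψ n / (n : ℝ)) * (Nat.totient n : ℝ) with hu
  let g : ℕ → ℕ := fun n => ⌊-Real.log (ψ n / n)⌋₊
  have hg : ∀ n, M ≤ n → 0 < ψ n → J' ≤ g n ∧ n ∈ block ψ N (g n) := by
    intro n hn hψ0
    have hnN : N ≤ n := (le_max_left _ _).trans hn
    have hn0 : (0 : ℝ) < n := by exact_mod_cast hN.trans hnN
    have hlog := hN₂ n ((le_max_right _ _).trans hn)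
    simp only [Function.comp_apply] at hlog
    have hx0 : 0 < ψ n / n := by positivity
    have h3 : Real.log (ψ n / n) ≤ -(2 / 3) * Real.log n := by
      rw [Real.log_div hψ0.ne' hn0.ne']
      have := Real.log_le_log hψ0 (hsmall n hnN).le
      rw [Real.log_rpow hn0] at this
      linarith
    have hL : (J' : ℝ) ≤ -Real.log (ψ n / n) := by
      have : (0 : ℝ) ≤ J' := Nat.cast_nonneg _
      linarith
    have hfl : (g n : ℝ) ≤ -Real.log (ψ n / n) := Nat.floor_le ((Nat.cast_nonneg J').trans hL)
    have hfl2 : -Real.log (ψ n / n) < g n + 1 := Nat.lt_floor_add_one _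
    refine ⟨Nat.le_floor hL, mem_block hN hnN (hsmall n hnN) ?_ ?_⟩
    · rw [← Real.lt_log_iff_exp_lt hx0]; linarith
    · rw [← Real.log_le_iff_le_exp hx0]; linarith
  have hblock : ∀ j, J' ≤ j → ∑ n ∈ block ψ N j, u n ≤ 1 / (j : ℝ) ^ 2 := by
    intro j hj
    have hj2 : 2 ≤ j := (le_max_right _ _).trans hj
    have hj0 : (0 : ℝ) < j := by exact_mod_cast (by omega : 0 < j)
    have h1 := (hcon j ((le_max_left _ _).trans hj) hj2).le
    set w := (j : ℝ) / (2 * Real.log (j + 1)) with hw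
    calc ∑ n ∈ block ψ N j, u n
        ≤ ∑ n ∈ block ψ N j, Real.exp (-j) * Real.exp (-w) * (n.totient : ℝ) := by
          refine Finset.sum_le_sum fun n hn => ?_
          obtain ⟨_, h2, h3⟩ := Finset.mem_filter.mp hn
          exact mul_le_mul_of_nonneg_right (f_le hj2 h2 h3) (Nat.cast_nonneg _)
      _ = Real.exp 1 * Real.exp (-w) *
          (Real.exp (-(j + 1)) * ∑ n ∈ block ψ N j, (n.totient : ℝ)) := by
          rw [← Finset.mul_sum, ← mul_assoc]
          congr 1
          rw [← Real.exp_add, ← Real.exp_add, ← Real.exp_add]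
          congr 1
          ring
      -- The denominator of `blockGain` is made for this: its e undoes the change from e^(-j) to
      -- e^(-(j+1)), and its j² makes the block sums summable.
      _ ≤ Real.exp 1 * Real.exp (-w) * blockGain j := by gcongr
      _ = 1 / (j : ℝ) ^ 2 := by
          rw [blockGain, ← hw, Real.exp_neg]
          have := Real.exp_pos w
          field_simp
  have hblock0 : ∀ j, ∀ n ∈ block ψ N j, J' ≤ j → 0 ≤ u n := by
    intro j n hn hj
    obtain ⟨_, h2, h3⟩ := Finset.mem_filter.mp hn
    refine mul_nonneg ?_ (Nat.cast_nonneg _)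
    have hx0 : 0 < ψ n / n := (Real.exp_pos _).trans h2
    rw [f, if_neg (not_le.mpr hx0)]
    split_ifs <;> positivity
  have htail : ∀ T : ℕ, ∑ n ∈ (Finset.Icc 1 T).filter (M ≤ ·), u n ≤
      ∑' j : ℕ, 1 / (j : ℝ) ^ 2 := by
    intro T
    set S := ((Finset.Icc 1 T).filter (M ≤ ·)).filter (fun n => 0 < ψ n) with hS
    have hS1 : ∑ n ∈ (Finset.Icc 1 T).filter (M ≤ ·), u n = ∑ n ∈ S, u n := by
      refine (Finset.sum_subset (Finset.filter_subset _ _) fun n hn hnS => ?_).symm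
      have hψ0 : ψ n ≤ 0 := by
        by_contra h
        exact hnS (Finset.mem_filter.mpr ⟨hn, not_le.mp h⟩)
      have : ψ n / n ≤ 0 := div_nonpos_of_nonpos_of_nonneg hψ0 (Nat.cast_nonneg _)
      simp [hu, f, this]
    rw [hS1, ← Finset.sum_fiberwise_of_maps_to (fun n hn => Finset.mem_image_of_mem g hn)]
    have hSg : ∀ n ∈ S, J' ≤ g n ∧ n ∈ block ψ N (g n) := fun n hn => by
      obtain ⟨h1, h2⟩ := Finset.mem_filter.mp hn
      exact hg n (Finset.mem_filter.mp h1).2 h2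
    calc ∑ j ∈ S.image g, ∑ n ∈ S.filter (fun n => g n = j), u n
        ≤ ∑ j ∈ S.image g, 1 / (j : ℝ) ^ 2 := by
          refine Finset.sum_le_sum fun j hj => ?_
          obtain ⟨n₀, hn₀, rfl⟩ := Finset.mem_image.mp hj
          have hJg := (hSg n₀ hn₀).1
          refine le_trans (Finset.sum_le_sum_of_subset_of_nonneg ?_ fun n hn _ =>
            hblock0 _ n hn hJg) (hblock _ hJg)
          intro n hn
          obtain ⟨h1, h2⟩ := Finset.mem_filter.mp hn
          rw [← h2]
          exact (hSg n h1).2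
      _ ≤ _ := hsum.sum_le_tsum _ fun _ _ => by positivity
  obtain ⟨T, hT⟩ := (hdiv.eventually_gt_atTop
    (∑ n ∈ Finset.Icc 1 M, |u n| + ∑' j : ℕ, 1 / (j : ℝ) ^ 2)).exists
  have h5 := htail T
  have h6 : ∑ n ∈ (Finset.Icc 1 T).filter (¬ M ≤ ·), u n ≤ ∑ n ∈ Finset.Icc 1 M, |u n| := by
    refine (Finset.sum_le_sum fun n _ => le_abs_self (u n)).trans
      (Finset.sum_le_sum_of_subset_of_nonneg (fun n hn => ?_) fun _ _ _ => abs_nonneg _)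
    obtain ⟨h1, h2⟩ := Finset.mem_filter.mp hn
    exact Finset.mem_Icc.mpr ⟨(Finset.mem_Icc.mp h1).1, (not_le.mp h2).le⟩
  rw [← Finset.sum_filter_add_sum_filter_not (Finset.Icc 1 T) (M ≤ ·)] at hT
  linarith

end DuffinSchaeffer

/-! ### The two cases combined. -/

theorem theorem1 (ψ : ℕ → ℝ) (hψ : ∀ n : ℕ, 1 ≤ n → 0 ≤ ψ n)
    (hdiv : Filter.Tendsto
      (fun N : ℕ => ∑ n ∈ Finset.Icc 1 N,
        DuffinSchaeffer.f (ψ n / (n : ℝ)) * (Nat.totient n : ℝ))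
      Filter.atTop Filter.atTop) :
    MeasureTheory.volume (DuffinSchaeffer.W ψ) = 1 := by
  open DuffinSchaeffer in
  -- The threshold n^(1/3) for ψ(n) is the truncation n^(-2/3) of the radius.
  by_cases hbig : ∃ᶠ n : ℕ in atTop, (n : ℝ) ^ (1 / 3 : ℝ) ≤ ψ n
  · obtain ⟨c, hc, hev⟩ := volume_single_ge
    refine volume_W_eq_one hψ hc fun N => ?_
    obtain ⟨n, hψn, hcn, hn⟩ := (hbig.and_eventually
      (hev.and (eventually_ge_atTop (max N 1)))).exists
    have hn1 : 0 < n := (le_max_right N 1).trans hn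
    have hn0 : (0 : ℝ) < n := by exact_mod_cast hn1
    have hpos : 0 < (n : ℝ) ^ (-(2 / 3) : ℝ) := by positivity
    have hrad : (n : ℝ) ^ (-(2 / 3) : ℝ) / 2 < truncatedRadius ψ n := by
      have h1 : (n : ℝ) ^ (-(2 / 3) : ℝ) ≤ ψ n / n := by
        rw [le_div_iff₀ hn0, ← Real.rpow_add_one hn0.ne']
        norm_num at hψn ⊢
        exact hψn
      rw [truncatedRadius, min_eq_right h1]
      linarith
    refine hcn.trans (measureReal_mono ?_ (measure_ne_top _ _))
    refine Set.iUnion₂_subset fun m hm => Set.iUnion₂_subset fun a ha => ?_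
    obtain rfl := Finset.mem_singleton.mp hm
    exact (closedBall_subset_approxAddOrderOf hn1 ha hrad).trans
      (Set.subset_biUnion_of_mem
        (u := fun n => approxAddOrderOf UnitAddCircle n (truncatedRadius ψ n))
        (show N ≤ m from (le_max_left N 1).trans hn))
  · rw [not_frequently] at hbig
    obtain ⟨N₁, hN₁⟩ := eventually_atTop.mp hbig
    obtain ⟨c, hc, J, hJ⟩ := volume_block_ge
    refine volume_W_eq_one hψ hc fun N => ?_
    set N' := max N (max N₁ 1) with hN'
    have hN'1 : 1 ≤ N' := (le_max_right N₁ 1).trans (le_max_right _ _)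
    have hsmall : ∀ n, N' ≤ n → ψ n < (n : ℝ) ^ (1 / 3 : ℝ) := fun n hn =>
      not_le.mp (hN₁ n (((le_max_left N₁ 1).trans (le_max_right _ _)).trans hn))
    obtain ⟨j, hJj, hj2, hgain⟩ := exists_block hdiv hN'1 hsmall J
    have hF : ∀ n ∈ block ψ N' j, N' ≤ n ∧ 0 < n ∧ Real.log n ≤ 1.5 * (j + 1) ∧
        Real.exp (-(j + 1)) < ψ n / n := by
      intro n hn
      obtain ⟨h1, h2, _⟩ := Finset.mem_filter.mp hn
      obtain ⟨h3, h4⟩ := Finset.mem_Icc.mp h1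
      have hn0 : 0 < n := hN'1.trans h3
      refine ⟨h3, hn0, ?_, h2⟩
      rw [Real.log_le_iff_le_exp (by exact_mod_cast hn0)]
      exact (Nat.le_floor_iff (Real.exp_pos _).le).mp h4
    have hne : (block ψ N' j).Nonempty := by
      by_contra h
      rw [Finset.not_nonempty_iff_eq_empty] at h
      rw [h, Finset.sum_empty, mul_zero, blockGain] at hgain
      -- Needed because `blockGain 0` is 0, by division by zero; an empty block is ruled out only
      -- when the gain is positive.
      have : (0 : ℝ) < j := by exact_mod_cast (by omega : 0 < j)
      exact absurd hgain (not_le.mpr (by positivity))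
    refine (hJ j hJj _ hne (fun n hn => ⟨(hF n hn).2.1, (hF n hn).2.2.1⟩) hgain).trans
      (measureReal_mono ?_ (measure_ne_top _ _))
    refine Set.iUnion₂_subset fun n hn => Set.iUnion₂_subset fun a ha => ?_
    obtain ⟨h1, h2, _, h3⟩ := hF n hn
    have hn0 : (0 : ℝ) < n := by exact_mod_cast h2
    have hrad : Real.exp (-(j + 1)) < truncatedRadius ψ n := by
      refine lt_min h3 (h3.trans ?_)
      rw [div_lt_iff₀ hn0, ← Real.rpow_add_one hn0.ne']
      have := hsmall n h1
      norm_num at this ⊢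
      exact this
    exact (closedBall_subset_approxAddOrderOf h2 ha hrad).trans
      (Set.subset_biUnion_of_mem
        (u := fun n => approxAddOrderOf UnitAddCircle n (truncatedRadius ψ n))
        (show N ≤ n from (le_max_left N _).trans h1))
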